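/- **Theorem (generalization of uncompressed neural networks).** Let $n=n_c\ge 1$, $N\ge 1$ and $q$ be integers, let $0<\omega_1<\omega_2=q\,\omega_1$, put $n_\rho=q\,n$, and let $\alpha>0$, $B_{out}>0$ and $B_K,B_D,B_{in},B_{tgt}\in\mathbb R$. Let $c_\omega=e^{i\pi/4}\omega^2/\sqrt{8\pi\omega}$. Write $\|\cdot\|_F$ for the Frobenius norm and $\|\cdot\|_2$ for the spectral norm of a matrix. *Networks.* Write $\Lambda\in\mathbb C^{2n\times n}$ as $\Lambda=\begin{bmatrix}\Lambda^{\omega_1}\\ \Lambda^{\omega_2}\end{bmatrix}$ with $\Lambda^{\omega_i}\in\mathbb C^{n\times n}$, and for $m=1,\dots,n$ let $\Lambda^{\omega}_{\theta_m}[i,j]=\Lambda^{\omega}[i+m,j+m]$ (indices modulo $n$). For $K\in\mathbb C^{n\times n_\rho}$, $D\in\mathbb C^{n\times n}$ define the row vectors of length $n_\rho$ $$\phi^0_1\Lambda^\omega_{\theta_m}=-\tfrac{2\pi^2c_\omega}{n^2}\,\mathrm{diag}\big(K^*(D^*\Lambda^\omega_{\theta_m}D+D\Lambda^\omega_{\theta_m}D^*)K\big),\qquad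 \phi^0_2\Lambda^\omega_{\theta_m}=\tfrac{4\pi^2c_\omega}{n^2}\,\mathrm{diag}\big(K^*\Lambda^\omega_{\theta_m}K\big),$$ let $P_\omega\in\mathbb R^{n_\rho\times n}$ have entries $P_\omega[i,j]=1$ if $i=\frac{\omega}{\omega_1}j$ and $0$ otherwise, and let $O_{k,\omega}$ be the $n\times n$ matrix whose $m$-th row is $(\phi^0_k\Lambda^\omega_{\theta_m})P_\omega$ ($k=1,2$). Set $$\phi^0(\Lambda)=\phi^0_{K,D}(\Lambda)=\sum_{i=1}^2\begin{bmatrix}O_{1,\omega_i}\\ O_{2,\omega_i}\end{bmatrix}\in\mathbb C^{2n\times n}.$$ Let $\mathcal H^0_{BFNN}$ be the set of all $\phi^0_{K,D}$ with $\|K\|_2\le B_K$, $\|D\|_2\le B_D$, and let $\mathcal H^0$ be the set of all maps $h=\psi\circ\psi_0\circ\phi^0$ with $\phi^0\in\mathcal H^0_{BFNN}$, with $\psi_0:\mathbb C^{2n\times n}\to\mathbb R^{2n\times n}$ and $\psi:\mathbb R^{2n\times n}\to\mathbb R^{2n\times n}$ real-linear, and $\|\psi_0(\cdot)\|_F\le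 2\|\cdot\|_F$, $\|\psi(\cdot)\|_F\le 2\alpha^{-1}\|\cdot\|_F$. *Data.* Let $\mu$ be a (Borel) probability measure on $\mathbb C^{2n\times n}\times\mathbb R^{2n\times n}$ such that for $\mu$-almost every $(\Lambda,y)$, with $y=(\gamma,\eta)^T$: $\|\Lambda\|_F\le B_{in}$, $\|y\|_F\le B_{tgt}$, $\|\phi^0(\Lambda)\|_F\le B_{out}$ for all $\phi^0\in\mathcal H^0_{BFNN}$, and $\|h(\Lambda)\|_F\le B_{out}$ for all $h\in\mathcal H^0$. Let $(\Lambda_s,y_s)$, $s=1,\dots,N$, be i.i.d. with law $\mu$, and put $$\mathcal L(h)=\mathbb E_{(\Lambda,y)\sim\mu}\|h(\Lambda)-y\|_F,\qquad \hat{\mathcal L}(h)=\frac1N\sum_{s=1}^N\|h(\Lambda_s)-y_s\|_F .$$ *Conclusion.* For every $\delta\in(0,1)$, with probability at least $1-\delta$, every $h\in\mathcal H^0$ satisfies $$\mathcal L(h)\le\hat{\mathcal L}(h)+4\Big(\sqrt{2\ln(4/\delta)}\,(B_{out}+B_{tgt})+192\sqrt{\omega_2/\omega_1}\;B_{out}\,\alpha^{-1}\big(1+c_0B_{out}^{-1}n_c^{-3/2}\big)^{1/2}n_c^3\Big)N^{-1/2},$$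 where $c_0=2^5\pi^2\,(|c_{\omega_1}|+|c_{\omega_2}|)\,(B_D^4+1)^{1/2}B_K^2B_{in}$. -/

import Mathlib

open MeasureTheory

namespace BFNN

noncomputable section

section FrobeniusNorm

open scoped Matrix.Norms.Frobenius

/-- The Frobenius norm of a real or complex matrix. -/
def frobNorm {𝕜 m n : Type*} [RCLike 𝕜] [Fintype m] [Fintype n] (A : Matrix m n 𝕜) : ℝ := ‖A‖

end FrobeniusNorm

section SpectralNorm

open scoped Matrix.Norms.L2Operator

/-- The spectral norm (the operator norm for the Euclidean norms) of a complex matrix. -/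
def specNorm {m n : Type*} [Fintype m] [Fintype n] [DecidableEq n] (A : Matrix m n ℂ) : ℝ :=
  ‖A‖

end SpectralNorm

/-- The entrywise (Borel) σ-algebra on matrices. -/
instance matrixMeasurableSpace {m n 𝕜 : Type*} [MeasurableSpace 𝕜] :
    MeasurableSpace (Matrix m n 𝕜) :=
  inferInstanceAs (MeasurableSpace (m → n → 𝕜))

/-- `2n × n` matrices; `Sum.inl` indexes the upper `n` rows and `Sum.inr` the lower `n` rows. -/
abbrev Stacked (n : ℕ) (𝕜 : Type) : Type := Matrix (Fin n ⊕ Fin n) (Fin n) 𝕜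

/-- The upper block (multiplication by `[I O]` from the left). -/
def upper {n : ℕ} (Λ : Stacked n ℂ) : Matrix (Fin n) (Fin n) ℂ := Matrix.toRows₁ Λ

/-- The lower block (multiplication by `[O I]` from the left). -/
def lower {n : ℕ} (Λ : Stacked n ℂ) : Matrix (Fin n) (Fin n) ℂ := Matrix.toRows₂ Λ

/-- The constant `c_ω = e^{iπ/4} ω² / √(8πω)`. -/
def cω (ω : ℝ) : ℂ :=
  Complex.exp (Complex.I * (Real.pi / 4 : ℝ)) * ((ω ^ 2 / Real.sqrt (8 * Real.pi * ω) : ℝ) : ℂ)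

/-- The cyclic shift `i ↦ i + k` modulo `n` of a row or column index. -/
def shiftIdx {n : ℕ} (k : ℕ) (i : Fin n) : Fin n := ⟨(i.val + k) % n, Nat.mod_lt _ i.pos⟩

/-- The shifted data `Λ_{θ_m}[i,j] = Λ[i+m, j+m]`, indices modulo `n`. The index `m : Fin n` is
zero-based, so it stands for the shift by `m + 1`, that is, for one of the shifts `1, …, n`. -/
def rotate {n : ℕ} (m : Fin n) (Λ : Matrix (Fin n) (Fin n) ℂ) : Matrix (Fin n) (Fin n) ℂ :=
  Matrix.of fun i j => Λ (shiftIdx (m.val + 1) i) (shiftIdx (m.val + 1) j)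

/-- `P_ω[i,j] = 1` if `i = (ω/ω₁) j` and `0` otherwise (one-based indices `i`, `j`). -/
def selectMat (n nρ : ℕ) (ω₁ ω : ℝ) : Matrix (Fin nρ) (Fin n) ℂ :=
  open Classical in
  Matrix.of fun i j => if ((i.val + 1 : ℕ) : ℝ) = ω / ω₁ * ((j.val + 1 : ℕ) : ℝ) then 1 else 0

variable {n nρ : ℕ}

/-- `φ₁⁰ Λ = -(2π² c_ω / n²) diag (K* (D* Λ D + D Λ D*) K)`. -/
def phi₁ (ω : ℝ) (K : Matrix (Fin n) (Fin nρ) ℂ) (D Λ : Matrix (Fin n) (Fin n) ℂ) : Fin nρ → ℂ :=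
  (-(2 * (Real.pi : ℂ) ^ 2 * cω ω / (n : ℂ) ^ 2)) •
    Matrix.diag (K.conjTranspose * (D.conjTranspose * Λ * D + D * Λ * D.conjTranspose) * K)

/-- `φ₂⁰ Λ = (4π² c_ω / n²) diag (K* Λ K)`. -/
def phi₂ (ω : ℝ) (K : Matrix (Fin n) (Fin nρ) ℂ) (Λ : Matrix (Fin n) (Fin n) ℂ) : Fin nρ → ℂ :=
  (4 * (Real.pi : ℂ) ^ 2 * cω ω / (n : ℂ) ^ 2) • Matrix.diag (K.conjTranspose * Λ * K)

/-- The matrix `(φ₁⁰ Λ_{θ_1}, …, φ₁⁰ Λ_{θ_n})ᵀ P_ω`, whose `m`-th row is `φ₁⁰ Λ_{θ_m}` times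
`P_ω`. -/
def block₁ (ω₁ ω : ℝ) (K : Matrix (Fin n) (Fin nρ) ℂ) (D Λ : Matrix (Fin n) (Fin n) ℂ) :
    Matrix (Fin n) (Fin n) ℂ :=
  (Matrix.of fun m => phi₁ ω K D (rotate m Λ)) * selectMat n nρ ω₁ ω

/-- The matrix `(φ₂⁰ Λ_{θ_1}, …, φ₂⁰ Λ_{θ_n})ᵀ P_ω`. -/
def block₂ (ω₁ ω : ℝ) (K : Matrix (Fin n) (Fin nρ) ℂ) (Λ : Matrix (Fin n) (Fin n) ℂ) :
    Matrix (Fin n) (Fin n) ℂ :=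
  (Matrix.of fun m => phi₂ ω K (rotate m Λ)) * selectMat n nρ ω₁ ω

/-- The uncompressed network `φ⁰` with parameters `K`, `D`: the upper block of the input holds the
data at frequency `ω₁`, the lower block those at frequency `ω₂`; the `φ₁⁰`-channels are summed into
the upper block of the output and the `φ₂⁰`-channels into the lower one. -/
def phiNet (ω₁ ω₂ : ℝ) (K : Matrix (Fin n) (Fin nρ) ℂ) (D : Matrix (Fin n) (Fin n) ℂ)
    (Λ : Stacked n ℂ) : Stacked n ℂ :=
  Matrix.fromRows
    (block₁ ω₁ ω₁ K D (upper Λ) + block₁ ω₁ ω₂ K D (lower Λ))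
    (block₂ ω₁ ω₁ K (upper Λ) + block₂ ω₁ ω₂ K (lower Λ))

/-- The class `H⁰_BFNN` of all networks `φ⁰` with `‖K‖₂ ≤ B_K` and `‖D‖₂ ≤ B_D`. -/
def classBFNN (n nρ : ℕ) (ω₁ ω₂ BK BD : ℝ) : Set (Stacked n ℂ → Stacked n ℂ) :=
  {φ | ∃ (K : Matrix (Fin n) (Fin nρ) ℂ) (D : Matrix (Fin n) (Fin n) ℂ),
    specNorm K ≤ BK ∧ specNorm D ≤ BD ∧ φ = phiNet ω₁ ω₂ K D}

/-- The hypothesis class `H⁰` of all `h = ψ ∘ ψ₀ ∘ φ⁰` with linear `ψ`, `ψ₀` such that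
`‖ψ‖ ≤ 2/α` and `‖ψ₀‖ ≤ 2` in the Frobenius norms. As the formula for `φ⁰` gives complex matrices
while `ψ` acts on real ones, `ψ₀` is any real-linear map from complex to real matrices (it may, but
need not, factor through the real part). -/
def classH (n nρ : ℕ) (ω₁ ω₂ α BK BD : ℝ) : Set (Stacked n ℂ → Stacked n ℝ) :=
  {h | ∃ (ψ : Stacked n ℝ →ₗ[ℝ] Stacked n ℝ) (ψ₀ : Stacked n ℂ →ₗ[ℝ] Stacked n ℝ),
    (∀ X, frobNorm (ψ X) ≤ 2 * α⁻¹ * frobNorm X) ∧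
    (∀ X, frobNorm (ψ₀ X) ≤ 2 * frobNorm X) ∧
    ∃ φ ∈ classBFNN n nρ ω₁ ω₂ BK BD, h = fun Λ => ψ (ψ₀ (φ Λ))}

/-- A data pair: scattering data `Λ` and target `(γ, η)ᵀ`. -/
abbrev Sample (n : ℕ) : Type := Stacked n ℂ × Stacked n ℝ

/-- The loss `‖h(Λ) - (γ, η)ᵀ‖_F`. -/
def loss (h : Stacked n ℂ → Stacked n ℝ) (z : Sample n) : ℝ := frobNorm (h z.1 - z.2)

/-- The empirical risk. -/
def empRisk {N : ℕ} (h : Stacked n ℂ → Stacked n ℝ) (S : Fin N → Sample n) : ℝ :=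
  (1 / (N : ℝ)) * ∑ s, loss h (S s)

/-- The true risk. -/
def risk (μ : Measure (Sample n)) (h : Stacked n ℂ → Stacked n ℝ) : ℝ := ∫ z, loss h z ∂μ

/-- `c₀ = 2⁵ π² (|c_{ω₁}| + |c_{ω₂}|) (B_D⁴ + 1)^{1/2} B_K² B_in`. -/
def c₀ (ω₁ ω₂ BK BD Bin : ℝ) : ℝ :=
  2 ^ 5 * Real.pi ^ 2 * (‖cω ω₁‖ + ‖cω ω₂‖) * Real.sqrt (BD ^ 4 + 1) * BK ^ 2 * Bin

end

end BFNN

/-!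
The formula for `φ⁰` is linear in the scattering data `Λ`, so every hypothesis `h = ψ ∘ ψ₀ ∘ φ⁰` is
a real-linear map of `Λ`, and `‖h(Λ)‖ ≤ (2/α) · 2 · ‖φ⁰(Λ)‖ ≤ 4 B_out / α` almost surely. Hence
the class lies in a ball of radius `4 B_out / α`, for the `L²(μ)` norm, of the space of linear maps
from a real space of dimension `4 n²` to one of dimension `2 n²`. The Rademacher average of such a
ball is at most its radius times `√(4 n² · 2 n² / N)`, and no covering numbers of the parameters
`K`, `D`, `ψ`, `ψ₀` are needed: this is smaller than the asserted rate by a factor of order `n`.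

To make the ball Euclidean, the functionals of `Λ` are written in a basis orthogonal for the second
moment form (`exists_orthonormal_features`); a degenerate form only costs a null set. In these
coordinates a hypothesis is a coefficient matrix, on which the loss depends in a 1-Lipschitz way.

The supremum of the deviations concentrates around its mean by McDiarmid's inequality
(`measure_ge_le_of_bounded_differences`). Its mean is compared with a Rademacher average one
observation at a time (`integral_iSup_sum_le`). For a single observation the comparison
(`integral_iSup_centered_le`) combines symmetrization with a vector contraction, which rests on the
inequality `√(∑ aₖ²) ≤ 2 E|∑ ± aₖ|` (`sqrt_sum_sq_le_integral_abs_signSum`). The average over the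
ball is computed by duality in `integral_iSup_sum_signSum_le`. All suprema are over finite sets, so
there are no measurability questions; the passage to the whole class in `uniform_deviation_of_pos`
uses a finite net of coefficients and an arbitrarily small loss, which the gap between the two rates
(`rate_lt`) absorbs.
-/

namespace BFNN

open ProbabilityTheory

/-! ### Finite suprema -/

section FiniteSup

variable {ι X : Type*} [Finite ι] {mX : MeasurableSpace X}

lemma le_iSup_finite (a : ι → ℝ) (i : ι) : a i ≤ ⨆ i, a i :=
  le_ciSup (Set.finite_range a).bddAbove i

lemma abs_iSup_sub_iSup_le [Nonempty ι] {a b : ι → ℝ} {c : ℝ} (h : ∀ i, |a i - b i| ≤ c) :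
    |(⨆ i, a i) - ⨆ i, b i| ≤ c := by
  rw [abs_sub_le_iff]
  constructor <;> rw [sub_le_iff_le_add] <;> refine ciSup_le fun i => ?_
  · linarith [le_iSup_finite b i, (abs_sub_le_iff.1 (h i)).1]
  · linarith [le_iSup_finite a i, (abs_sub_le_iff.1 (h i)).2]

lemma integrable_iSup [Nonempty ι] {μ : Measure X} {f : ι → X → ℝ} (hm : ∀ i, Measurable (f i))
    (hf : ∀ i, Integrable (f i) μ) : Integrable (fun x => ⨆ i, f i x) μ := by
  cases nonempty_fintype ι
  refine Integrable.mono' (integrable_finsetSum Finset.univ fun i _ => (hf i).abs)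
    (Measurable.iSup hm).aestronglyMeasurable (.of_forall fun x => ?_)
  have hle : ∀ i, |f i x| ≤ ∑ i, |f i x| := fun i =>
    Finset.single_le_sum (f := fun i => |f i x|) (fun _ _ => abs_nonneg _) (Finset.mem_univ i)
  obtain ⟨i₀⟩ := ‹Nonempty ι›
  rw [Real.norm_eq_abs, abs_le]
  exact ⟨(neg_le_of_abs_le (hle i₀)).trans (le_iSup_finite (f · x) i₀),
    ciSup_le fun i => (le_abs_self _).trans (hle i)⟩

end FiniteSup

/-! ### Independent samples -/

section Product

variable {Z : Type*} {mZ : MeasurableSpace Z} {μ : Measure Z} [IsProbabilityMeasure μ]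

lemma measurePreserving_cons (μ : Measure Z) [IsProbabilityMeasure μ] (N : ℕ) :
    MeasurePreserving (fun p : Z × (Fin N → Z) => (Fin.cons p.1 p.2 : Fin (N + 1) → Z))
      (μ.prod (Measure.pi fun _ => μ)) (Measure.pi fun _ => μ) := by
  have h := (measurePreserving_piFinSuccAbove (fun _ : Fin (N + 1) => μ) 0).symm
  convert h using 1
  ext p s
  refine Fin.cases ?_ (fun s => ?_) s <;> simp [MeasurableEquiv.piFinSuccAbove]

lemma integral_pi_succ {N : ℕ} {f : (Fin (N + 1) → Z) → ℝ}
    (hf : Integrable f (Measure.pi fun _ => μ)) :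
    ∫ S, f S ∂(Measure.pi fun _ => μ)
      = ∫ z, ∫ S, f (Fin.cons z S) ∂(Measure.pi fun _ : Fin N => μ) ∂μ := by
  have hp := measurePreserving_cons μ N
  rw [← hp.map_eq, integral_map hp.measurable.aemeasurable, integral_prod]
  · exact hp.integrable_comp_of_integrable hf
  · rw [hp.map_eq]; exact hf.aestronglyMeasurable

lemma integrable_sum_eval {N : ℕ} {f : Z → ℝ} (hf : Integrable f μ) :
    Integrable (fun S : Fin N → Z => ∑ s, f (S s)) (Measure.pi fun _ => μ) :=
  integrable_finsetSum _ fun s _ => integrable_comp_eval (μ := fun _ : Fin N => μ) (i := s) hf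

end Product

/-! ### Exchanging independent summands -/

/-- A comparison between the mean suprema of two finite families of functions that holds for
every choice of offsets `A` passes to sums over independent samples: the summands are exchanged
one at a time, the others being absorbed in `A`. -/
lemma integral_iSup_sum_le {ι Z W : Type*} [Finite ι] [Nonempty ι]
    {mZ : MeasurableSpace Z} {mW : MeasurableSpace W}
    {μ : Measure Z} [IsProbabilityMeasure μ] {ν : Measure W} [IsProbabilityMeasure ν]
    {f : ι → Z → ℝ} {g : ι → W → ℝ} (hfm : ∀ i, Measurable (f i)) (hgm : ∀ i, Measurable (g i))
    (hf : ∀ i, Integrable (f i) μ) (hg : ∀ i, Integrable (g i) ν)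
    (H : ∀ A : ι → ℝ, ∫ z, ⨆ i, (A i + f i z) ∂μ ≤ ∫ w, ⨆ i, (A i + g i w) ∂ν)
    (N : ℕ) (A : ι → ℝ) :
    ∫ S : Fin N → Z, ⨆ i, (A i + ∑ s, f i (S s)) ∂(Measure.pi fun _ => μ)
      ≤ ∫ T : Fin N → W, ⨆ i, (A i + ∑ s, g i (T s)) ∂(Measure.pi fun _ => ν) := by
  induction N generalizing A with
  | zero => simp
  | succ N ih =>
    have hmix : Integrable (fun p : Z × (Fin N → W) => ⨆ i, (A i + f i p.1 + ∑ s, g i (p.2 s)))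
        (μ.prod (Measure.pi fun _ => ν)) := by
      refine integrable_iSup (fun i => ?_) fun i => ?_
      · fun_prop
      · exact ((integrable_const _).add ((hf i).comp_fst _)).add
          ((integrable_sum_eval (hg i)).comp_snd _)
    have hgg : Integrable (fun p : W × (Fin N → W) => ⨆ i, (A i + g i p.1 + ∑ s, g i (p.2 s)))
        (ν.prod (Measure.pi fun _ => ν)) := by
      refine integrable_iSup (fun i => ?_) fun i => ?_
      · fun_prop
      · exact ((integrable_const _).add ((hg i).comp_fst _)).add
          ((integrable_sum_eval (hg i)).comp_snd _)
    have hff : Integrable (fun p : Z × (Fin N → Z) => ⨆ i, (A i + f i p.1 + ∑ s, f i (p.2 s)))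
        (μ.prod (Measure.pi fun _ => μ)) := by
      refine integrable_iSup (fun i => ?_) fun i => ?_
      · fun_prop
      · exact ((integrable_const _).add ((hf i).comp_fst _)).add
          ((integrable_sum_eval (hf i)).comp_snd _)
    rw [integral_pi_succ, integral_pi_succ]
    · simp only [Fin.sum_univ_succ, Fin.cons_zero, Fin.cons_succ, ← add_assoc]
      calc _ ≤ ∫ z, ∫ T : Fin N → W, ⨆ i, (A i + f i z + ∑ s, g i (T s))
              ∂(Measure.pi fun _ => ν) ∂μ :=
            integral_mono hff.integral_prod_left hmix.integral_prod_left fun z =>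
              ih fun i => A i + f i z
        _ = ∫ T : Fin N → W, ∫ z, ⨆ i, (A i + f i z + ∑ s, g i (T s))
              ∂μ ∂(Measure.pi fun _ => ν) := integral_integral_swap hmix
        _ ≤ ∫ T : Fin N → W, ∫ w, ⨆ i, (A i + g i w + ∑ s, g i (T s))
              ∂ν ∂(Measure.pi fun _ => ν) := by
            refine integral_mono hmix.integral_prod_right hgg.integral_prod_right fun T => ?_
            simpa only [add_right_comm] using H fun i => A i + ∑ s, g i (T s)
        _ = _ := (integral_integral_swap hgg).symm
    · refine integrable_iSup (fun i => ?_) fun i => ?_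
      · fun_prop
      · exact (integrable_const _).add (integrable_sum_eval (hg i))
    · refine integrable_iSup (fun i => ?_) fun i => ?_
      · fun_prop
      · exact (integrable_const _).add (integrable_sum_eval (hf i))

/-! ### Bounded differences -/

section BoundedDifferences

variable {Z : Type*} {mZ : MeasurableSpace Z} {μ : Measure Z} [IsProbabilityMeasure μ]

/-- The moment generating function bound behind McDiarmid's inequality: conditionally on the
other coordinates each coordinate contributes a variable with values in an interval of length
`c`, to which Hoeffding's lemma applies. -/
lemma integral_exp_le_of_bounded_differences {N : ℕ} {f : (Fin N → Z) → ℝ} (hf : Measurable f)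
    {M c : ℝ} (hc : 0 ≤ c) (hM : ∀ S, |f S| ≤ M)
    (hd : ∀ S s z, |f (Function.update S s z) - f S| ≤ c) (t : ℝ) :
    ∫ S, Real.exp (t * (f S - ∫ S, f S ∂(Measure.pi fun _ => μ))) ∂(Measure.pi fun _ => μ)
      ≤ Real.exp (N * (c / 2) ^ 2 * t ^ 2 / 2) := by
  induction N with
  | zero =>
    have h0 : ∀ S : Fin 0 → Z, f S = f default := fun S => congrArg f (Subsingleton.elim _ _)
    simp [h0]
  | succ N ih =>
    have hcons := (measurePreserving_cons μ N).measurable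
    have hfc : Measurable fun p : Z × (Fin N → Z) => f (Fin.cons p.1 p.2) := hf.comp hcons
    have hfz : ∀ z, Measurable fun S : Fin N → Z => f (Fin.cons z S) := fun z =>
      hfc.comp measurable_prodMk_left
    have hint : ∀ z, Integrable (fun S : Fin N → Z => f (Fin.cons z S))
        (Measure.pi fun _ => μ) := fun z =>
      Integrable.of_bound (hfz z).aestronglyMeasurable M (.of_forall fun S => hM _)
    set g : Z → ℝ := fun z => ∫ S : Fin N → Z, f (Fin.cons z S) ∂(Measure.pi fun _ => μ) with hg
    have hgm : Measurable g := hfc.stronglyMeasurable.integral_prod_right.measurable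
    have hgM : ∀ z, |g z| ≤ M := fun z => by
      simpa using norm_integral_le_of_norm_le_const (μ := Measure.pi fun _ : Fin N => μ)
        (f := fun S => f (Fin.cons z S)) (C := M) (.of_forall fun S => hM _)
    have hgd : ∀ z z', |g z - g z'| ≤ c := fun z z' => by
      rw [hg]
      simp only
      rw [← integral_sub (hint z) (hint z')]
      simpa using norm_integral_le_of_norm_le_const (μ := Measure.pi fun _ : Fin N => μ)
        (f := fun S => f (Fin.cons z S) - f (Fin.cons z' S)) (C := c)
        (.of_forall fun S => by simpa using hd (Fin.cons z' S) 0 z)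
    have hmean : ∫ S, f S ∂(Measure.pi fun _ => μ) = ∫ z, g z ∂μ :=
      integral_pi_succ (Integrable.of_bound hf.aestronglyMeasurable M (.of_forall hM))
    have hexpB : ∀ a b : ℝ, |a| ≤ M → |b| ≤ M →
        ‖Real.exp (t * (a - b))‖ ≤ Real.exp (|t| * (2 * M)) := fun a b ha hb => by
      rw [Real.norm_eq_abs, Real.abs_exp, Real.exp_le_exp]
      calc t * (a - b) ≤ |t| * |a - b| := by rw [← abs_mul]; exact le_abs_self _
        _ ≤ |t| * (2 * M) := by
          gcongr
          calc |a - b| ≤ |a| + |b| := abs_sub a b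
            _ ≤ 2 * M := by linarith
    have hmeanM : |∫ z, g z ∂μ| ≤ M := by
      simpa using norm_integral_le_of_norm_le_const (μ := μ) (f := g) (C := M) (.of_forall hgM)
    rw [hmean, integral_pi_succ (Integrable.of_bound (by fun_prop) (Real.exp (|t| * (2 * M)))
      (.of_forall fun S => hexpB _ _ (hM S) hmeanM))]
    have hstep : ∀ z, ∫ S : Fin N → Z, Real.exp (t * (f (Fin.cons z S) - ∫ z, g z ∂μ))
          ∂(Measure.pi fun _ => μ)
        ≤ Real.exp (t * (g z - ∫ z, g z ∂μ)) * Real.exp (N * (c / 2) ^ 2 * t ^ 2 / 2) := by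
      intro z
      have := ih (hfz z) (fun S => hM _) fun S s z' => by
        rw [Fin.cons_update]; exact hd _ _ _
      calc _ = Real.exp (t * (g z - ∫ z, g z ∂μ)) *
            ∫ S : Fin N → Z, Real.exp (t * (f (Fin.cons z S) - g z))
              ∂(Measure.pi fun _ => μ) := by
            rw [← integral_const_mul]
            congr 1 with S
            rw [← Real.exp_add]; ring_nf
        _ ≤ _ := by gcongr
    have hrange : ∀ z, g z ∈ Set.Icc (⨅ z, g z) ((⨅ z, g z) + c) := fun z => by
      have hne : Nonempty Z := ⟨z⟩
      have hbdd : BddBelow (Set.range g) := ⟨-M, by rintro _ ⟨z, rfl⟩; exact (abs_le.1 (hgM z)).1⟩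
      refine ⟨ciInf_le hbdd z, ?_⟩
      have : g z - c ≤ ⨅ z, g z := le_ciInf fun z' => by linarith [(abs_le.1 (hgd z z')).2]
      linarith
    have hhoeff := (hasSubgaussianMGF_of_mem_Icc hgm.aemeasurable
      (.of_forall hrange : ∀ᵐ z ∂μ, _)).mgf_le t
    rw [mgf] at hhoeff
    calc _ ≤ ∫ z, Real.exp (t * (g z - ∫ z, g z ∂μ))
            * Real.exp (N * (c / 2) ^ 2 * t ^ 2 / 2) ∂μ := by
          refine integral_mono ?_ ?_ hstep
          · have : Integrable (fun p : Z × (Fin N → Z) =>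
                Real.exp (t * (f (Fin.cons p.1 p.2) - ∫ z, g z ∂μ)))
                (μ.prod (Measure.pi fun _ => μ)) :=
              Integrable.of_bound
                (Real.measurable_exp.comp ((hfc.sub_const _).const_mul t)).aestronglyMeasurable
                (Real.exp (|t| * (2 * M))) (.of_forall fun S => hexpB _ _ (hM _) hmeanM)
            exact this.integral_prod_left
          · exact (Integrable.of_bound (by fun_prop) (Real.exp (|t| * (2 * M)))
                (.of_forall fun S => hexpB _ _ (hgM _) hmeanM)).mul_const _
      _ ≤ Real.exp ((c / 2) ^ 2 * t ^ 2 / 2) * Real.exp (N * (c / 2) ^ 2 * t ^ 2 / 2) := by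
          rw [integral_mul_const]
          gcongr
          simpa [abs_of_nonneg hc] using hhoeff
      _ = _ := by
          rw [← Real.exp_add]; push_cast; ring_nf

/-- **McDiarmid's inequality** for a function of i.i.d. variables with bounded differences. -/
lemma measure_ge_le_of_bounded_differences {N : ℕ} {f : (Fin N → Z) → ℝ} (hf : Measurable f)
    {M c t : ℝ} (hc : 0 ≤ c) (ht : 0 ≤ t) (hM : ∀ S, |f S| ≤ M)
    (hd : ∀ S s z, |f (Function.update S s z) - f S| ≤ c) :
    (Measure.pi fun _ => μ).real {S | t ≤ f S - ∫ S, f S ∂(Measure.pi fun _ => μ)}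
      ≤ Real.exp (-t ^ 2 / (2 * (N * (c / 2) ^ 2))) := by
  have hsub : HasSubgaussianMGF (fun S => f S - ∫ S, f S ∂(Measure.pi fun _ => μ))
      (N * (⟨c, hc⟩ / 2) ^ 2 : NNReal) (Measure.pi fun _ : Fin N => μ) := by
    refine ⟨fun t => ?_, fun t => ?_⟩
    · have hmean : |∫ S, f S ∂(Measure.pi fun _ => μ)| ≤ M := by
        simpa using norm_integral_le_of_norm_le_const (μ := Measure.pi fun _ : Fin N => μ)
          (f := f) (C := M) (.of_forall hM)
      refine Integrable.of_bound (by fun_prop) (Real.exp (|t| * (2 * M))) (.of_forall fun S => ?_)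
      rw [Real.norm_eq_abs, Real.abs_exp, Real.exp_le_exp]
      calc t * (f S - ∫ S, f S ∂(Measure.pi fun _ => μ))
          ≤ |t| * |f S - ∫ S, f S ∂(Measure.pi fun _ => μ)| := by
            rw [← abs_mul]; exact le_abs_self _
        _ ≤ |t| * (2 * M) := by
          gcongr
          refine (abs_sub _ _).trans ?_
          linarith [hM S]
    · exact integral_exp_le_of_bounded_differences hf hc hM hd t
  exact hsub.measure_ge_le ht

end BoundedDifferences

/-! ### Rademacher signs -/

section Signs

/-- The sign `±1` encoded by a Boolean. -/
def boolSign (b : Bool) : ℝ := if b then 1 else -1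

/-- The law of `m` independent Rademacher signs, encoded as Booleans. -/
noncomputable def signLaw (m : ℕ) : Measure (Fin m → Bool) :=
  Measure.pi fun _ => (PMF.uniformOfFintype Bool).toMeasure

instance (m : ℕ) : IsProbabilityMeasure (signLaw m) := by unfold signLaw; infer_instance

/-- The signed sum `∑ ± aₖ`. -/
def signSum {m : ℕ} (b : Fin m → Bool) (a : Fin m → ℝ) : ℝ := ∑ k, boolSign (b k) * a k

lemma boolSign_sq (b : Bool) : boolSign b ^ 2 = 1 := by cases b <;> norm_num [boolSign]

lemma boolSign_not (b : Bool) : boolSign (!b) = -boolSign b := by cases b <;> norm_num [boolSign]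

lemma signSum_not {m : ℕ} (b : Fin m → Bool) (a : Fin m → ℝ) :
    signSum (fun k => !b k) a = -signSum b a := by
  simp [signSum, boolSign_not]

lemma signSum_sub {m : ℕ} (b : Fin m → Bool) (a a' : Fin m → ℝ) :
    signSum b (fun k => a k - a' k) = signSum b a - signSum b a' := by
  simp [signSum, mul_sub]

lemma integral_uniform_bool (F : Bool → ℝ) :
    ∫ b, F b ∂(PMF.uniformOfFintype Bool).toMeasure = (F true + F false) / 2 := by
  rw [PMF.integral_eq_sum]
  simp
  ring

lemma measurePreserving_not (m : ℕ) :
    MeasurePreserving (fun (b : Fin m → Bool) k => !b k) (signLaw m) (signLaw m) := by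
  refine measurePreserving_pi _ _ fun _ => ⟨measurable_of_finite _, ?_⟩
  refine Measure.ext_of_singleton fun b => ?_
  rw [Measure.map_apply (measurable_of_finite _) (measurableSet_singleton b),
    show (fun b : Bool => !b) ⁻¹' {b} = {!b} by ext x; cases x <;> cases b <;> simp,
    PMF.toMeasure_apply_singleton _ _ (measurableSet_singleton _),
    PMF.toMeasure_apply_singleton _ _ (measurableSet_singleton _)]
  simp

lemma integral_signLaw_not {m : ℕ} (F : (Fin m → Bool) → ℝ) :
    ∫ b, F (fun k => !b k) ∂(signLaw m) = ∫ b, F b ∂(signLaw m) := by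
  have h := measurePreserving_not m
  conv_rhs => rw [← h.map_eq, integral_map h.measurable.aemeasurable (by
    exact (measurable_of_finite F).aestronglyMeasurable)]

lemma integral_signLaw_succ {m : ℕ} (F : (Fin (m + 1) → Bool) → ℝ) :
    ∫ b, F b ∂(signLaw (m + 1))
      = ∫ b, (F (Fin.cons true b) + F (Fin.cons false b)) / 2 ∂(signLaw m) := by
  unfold signLaw
  rw [integral_pi_succ .of_finite, integral_uniform_bool, integral_div,
    integral_add .of_finite .of_finite]

lemma signSum_cons {m : ℕ} (x : Bool) (b : Fin m → Bool) (a : Fin (m + 1) → ℝ) :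
    signSum (Fin.cons x b) a = boolSign x * a 0 + signSum b (fun k => a k.succ) := by
  simp [signSum, Fin.sum_univ_succ]

lemma integral_signSum_sq {m : ℕ} (a : Fin m → ℝ) :
    ∫ b, signSum b a ^ 2 ∂(signLaw m) = ∑ k, a k ^ 2 := by
  induction m with
  | zero => simp [signSum]
  | succ m ih =>
    rw [integral_signLaw_succ, Fin.sum_univ_succ, ← ih, ← sub_eq_iff_eq_add',
      ← sub_eq_zero]
    have : ∀ b : Fin m → Bool,
        (signSum (Fin.cons true b) a ^ 2 + signSum (Fin.cons false b) a ^ 2) / 2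
        = a 0 ^ 2 + signSum b (fun k => a k.succ) ^ 2 := fun b => by
      rw [signSum_cons, signSum_cons]; simp [boolSign]; ring
    simp_rw [this]
    rw [integral_add .of_finite .of_finite]
    simp

lemma integral_signSum_pow_four_le {m : ℕ} (a : Fin m → ℝ) :
    ∫ b, signSum b a ^ 4 ∂(signLaw m) ≤ 3 * (∑ k, a k ^ 2) ^ 2 := by
  induction m with
  | zero => simp [signSum]
  | succ m ih =>
    have : ∀ b : Fin m → Bool,
        (signSum (Fin.cons true b) a ^ 4 + signSum (Fin.cons false b) a ^ 4) / 2
        = a 0 ^ 4 + 6 * a 0 ^ 2 * signSum b (fun k => a k.succ) ^ 2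
          + signSum b (fun k => a k.succ) ^ 4 := fun b => by
      rw [signSum_cons, signSum_cons]; simp [boolSign]; ring
    rw [integral_signLaw_succ]
    simp_rw [this]
    rw [integral_add .of_finite .of_finite, integral_add .of_finite .of_finite,
      integral_const_mul, integral_signSum_sq, Fin.sum_univ_succ]
    simp only [integral_const, probReal_univ, one_smul]
    nlinarith [ih fun k => a k.succ, sq_nonneg (a 0 ^ 2)]

/-- A Khintchine inequality: the fourth moment controls how far `∑ ± aₖ` can concentrate near
zero, through the pointwise bound `|x| ≥ r (3 x² / (4 r²) - x⁴ / (16 r⁴))`. -/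
lemma sqrt_sum_sq_le_integral_abs_signSum {m : ℕ} (a : Fin m → ℝ) :
    √(∑ k, a k ^ 2) ≤ 2 * ∫ b, |signSum b a| ∂(signLaw m) := by
  set R := ∑ k, a k ^ 2 with hR
  have hR0 : 0 ≤ R := Finset.sum_nonneg fun _ _ => sq_nonneg _
  rcases hR0.eq_or_lt with h0 | hpos
  · rw [← h0, Real.sqrt_zero]
    have : 0 ≤ ∫ b, |signSum b a| ∂(signLaw m) := integral_nonneg fun _ => abs_nonneg _
    linarith
  -- The quartic minorant of `|x|` touches it at `|x| = 2 r` and has mean at least `9 r / 16`.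
  set r := √R with hr
  have hrpos : 0 < r := Real.sqrt_pos.2 hpos
  have hrsq : r ^ 2 = R := Real.sq_sqrt hR0
  have hpt : ∀ b, 3 / (4 * r) * signSum b a ^ 2 - 1 / (16 * r ^ 3) * signSum b a ^ 4
      ≤ |signSum b a| := fun b => by
    set x := signSum b a
    have hx2 : x ^ 2 = |x| ^ 2 := (sq_abs x).symm
    have hx4 : x ^ 4 = |x| ^ 4 := by rw [show 4 = 2 * 2 from rfl, pow_mul, hx2, ← pow_mul]
    rw [hx2, hx4]
    have hkey : |x| - (3 / (4 * r) * |x| ^ 2 - 1 / (16 * r ^ 3) * |x| ^ 4)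
        = |x| * (|x| - 2 * r) ^ 2 * (|x| + 4 * r) / (16 * r ^ 3) := by
      field_simp; ring
    have : 0 ≤ |x| * (|x| - 2 * r) ^ 2 * (|x| + 4 * r) / (16 * r ^ 3) := by positivity
    linarith
  have hint : 3 / (4 * r) * R - 1 / (16 * r ^ 3) * ∫ b, signSum b a ^ 4 ∂(signLaw m)
      ≤ ∫ b, |signSum b a| ∂(signLaw m) := by
    rw [hR, ← integral_signSum_sq, ← integral_const_mul, ← integral_const_mul,
      ← integral_sub .of_finite .of_finite]
    exact integral_mono .of_finite .of_finite hpt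
  have h4 : 1 / (16 * r ^ 3) * ∫ b, signSum b a ^ 4 ∂(signLaw m)
      ≤ 1 / (16 * r ^ 3) * (3 * R ^ 2) := by
    gcongr
    exact integral_signSum_pow_four_le a
  have : 3 / (4 * r) * R - 1 / (16 * r ^ 3) * (3 * R ^ 2) = 9 / 16 * r := by
    rw [← hrsq]; field_simp; ring
  linarith

end Signs

/-! ### Symmetrization and contraction -/

section Contraction

variable {ι : Type*} [Finite ι] [Nonempty ι] {m : ℕ}

/-- The vector contraction principle for one observation: the two signs of the loss `l`,
which is 1-Lipschitz in the vectors `v i`, are replaced by a random sign for each coordinate. -/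
lemma iSup_add_iSup_le_integral_signSum (A l : ι → ℝ) (v : ι → Fin m → ℝ)
    (hl : ∀ i j, |l i - l j| ≤ √(∑ k, (v i k - v j k) ^ 2)) :
    (⨆ i, (A i + 2 * l i)) + ⨆ i, (A i - 2 * l i)
      ≤ 2 * ∫ b, ⨆ i, (A i + 4 * signSum b (v i)) ∂(signLaw m) := by
  obtain ⟨i, hi⟩ := exists_eq_ciSup_of_finite (f := fun i => A i + 2 * l i)
  obtain ⟨j, hj⟩ := exists_eq_ciSup_of_finite (f := fun i => A i - 2 * l i)
  rw [← hi, ← hj]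
  have hflip : ∫ b, ⨆ i, (A i - 4 * signSum b (v i)) ∂(signLaw m)
      = ∫ b, ⨆ i, (A i + 4 * signSum b (v i)) ∂(signLaw m) := by
    rw [← integral_signLaw_not]
    simp_rw [signSum_not, mul_neg, sub_neg_eq_add]
  calc A i + 2 * l i + (A j - 2 * l j) ≤ A i + A j + 2 * |l i - l j| := by
        linarith [le_abs_self (l i - l j)]
    _ ≤ A i + A j + 4 * ∫ b, |signSum b (fun k => v i k - v j k)| ∂(signLaw m) := by
        linarith [hl i j, sqrt_sum_sq_le_integral_abs_signSum fun k => v i k - v j k]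
    _ = ∫ b, (A i + A j + 4 * |signSum b (v i) - signSum b (v j)|) ∂(signLaw m) := by
        simp_rw [signSum_sub]
        rw [integral_add .of_finite .of_finite, integral_const_mul]
        simp
    _ ≤ ∫ b, ((⨆ i, (A i + 4 * signSum b (v i))) + ⨆ i, (A i - 4 * signSum b (v i)))
          ∂(signLaw m) := by
        refine integral_mono .of_finite .of_finite fun b => ?_
        have h1 := le_iSup_finite (fun i => A i + 4 * signSum b (v i))
        have h2 := le_iSup_finite (fun i => A i - 4 * signSum b (v i))
        rcases abs_cases (signSum b (v i) - signSum b (v j)) with h | h <;> simp only [h.1]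
        · linarith [h1 i, h2 j]
        · linarith [h1 j, h2 i]
    _ = _ := by
        rw [integral_add .of_finite .of_finite, hflip]; ring

variable {Z : Type*} {mZ : MeasurableSpace Z} {μ : Measure Z} [IsProbabilityMeasure μ]

lemma measurable_boolSign : Measurable boolSign := measurable_of_finite _

/-- Symmetrization and contraction for a single observation, with arbitrary offsets `A`. The
identity `A + l(z') - l(z) = (A + 2 l(z')) / 2 + (A - 2 l(z)) / 2` decouples the ghost
observation `z'` without introducing a sign for it. -/
lemma integral_iSup_centered_le {l : ι → Z → ℝ} {v : ι → Z → Fin m → ℝ}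
    (hlm : ∀ i, Measurable (l i)) (hli : ∀ i, Integrable (l i) μ)
    (hvm : ∀ i k, Measurable fun z => v i z k) (hvi : ∀ i k, Integrable (fun z => v i z k) μ)
    (hl : ∀ i j z, |l i z - l j z| ≤ √(∑ k, (v i z k - v j z k) ^ 2)) (A : ι → ℝ) :
    ∫ z, ⨆ i, (A i + (∫ z, l i z ∂μ - l i z)) ∂μ
      ≤ ∫ w : Z × (Fin m → Bool), ⨆ i, (A i + 4 * signSum w.2 (v i w.1))
        ∂(μ.prod (signLaw m)) := by
  have hp : Integrable (fun z => ⨆ i, (A i + 2 * l i z)) μ :=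
    integrable_iSup (fun i => by have := hlm i; fun_prop)
      fun i => (integrable_const _).add ((hli i).const_mul 2)
  have hn : Integrable (fun z => ⨆ i, (A i - 2 * l i z)) μ :=
    integrable_iSup (fun i => by have := hlm i; fun_prop)
      fun i => (integrable_const _).sub ((hli i).const_mul 2)
  have hc : Integrable (fun z => ⨆ i, (A i + (∫ z, l i z ∂μ - l i z))) μ :=
    integrable_iSup (fun i => by have := hlm i; fun_prop)
      fun i => (integrable_const _).add ((integrable_const _).sub (hli i))
  have hs : Integrable (fun w : Z × (Fin m → Bool) => ⨆ i, (A i + 4 * signSum w.2 (v i w.1)))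
      (μ.prod (signLaw m)) := by
    refine integrable_iSup (fun i => ?_) fun i => (integrable_const _).add (.const_mul ?_ 4)
    · have := hvm i
      have := measurable_boolSign
      unfold signSum
      fun_prop
    · refine integrable_finsetSum _ fun k _ => ?_
      have hb : Integrable (fun b : Fin m → Bool => boolSign (b k)) (signLaw m) := .of_finite
      simpa only [mul_comm] using (hvi i k).mul_prod hb
  calc ∫ z, ⨆ i, (A i + (∫ z, l i z ∂μ - l i z)) ∂μ
      ≤ ∫ z, (1 / 2 * (∫ z', ⨆ i, (A i + 2 * l i z') ∂μ) + 1 / 2 * ⨆ i, (A i - 2 * l i z)) ∂μ := by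
        refine integral_mono hc ((integrable_const _).add (hn.const_mul _)) fun z => ?_
        refine ciSup_le fun i => ?_
        have h1 : A i + 2 * ∫ z, l i z ∂μ ≤ ∫ z', ⨆ i, (A i + 2 * l i z') ∂μ := by
          calc A i + 2 * ∫ z, l i z ∂μ = ∫ z, (A i + 2 * l i z) ∂μ := by
                rw [integral_add (integrable_const _) ((hli i).const_mul 2), integral_const_mul]
                simp
            _ ≤ _ := integral_mono ((integrable_const _).add ((hli i).const_mul 2)) hp
                fun z => le_iSup_finite (fun i => A i + 2 * l i z) i
        have h2 := le_iSup_finite (fun i => A i - 2 * l i z) i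
        linarith
    _ = ∫ z, 1 / 2 * ((⨆ i, (A i + 2 * l i z)) + ⨆ i, (A i - 2 * l i z)) ∂μ := by
        rw [integral_add (integrable_const _) (hn.const_mul _), integral_const_mul,
          integral_const_mul, integral_const_mul, integral_add hp hn]
        simp
        ring
    _ ≤ ∫ z, ∫ b, ⨆ i, (A i + 4 * signSum b (v i z)) ∂(signLaw m) ∂μ := by
        refine integral_mono ((hp.add hn).const_mul _) hs.integral_prod_left fun z => ?_
        have := iSup_add_iSup_le_integral_signSum A (fun i => l i z) (fun i => v i z)
          fun i j => hl i j z
        simp only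
        linarith
    _ = _ := (integral_prod _ hs).symm

end Contraction

/-! ### Rademacher averages of linear maps -/

section LinearClass

/-- The second moment of a sum of i.i.d. centred square-integrable variables. -/
lemma integral_sum_sq_of_mean_zero {W : Type*} {mW : MeasurableSpace W} {ν : Measure W}
    [IsProbabilityMeasure ν] {x : W → ℝ} (hx : MemLp x 2 ν) (h0 : ∫ w, x w ∂ν = 0) (N : ℕ) :
    ∫ T : Fin N → W, (∑ s, x (T s)) ^ 2 ∂(Measure.pi fun _ => ν) = N * ∫ w, x w ^ 2 ∂ν := by
  have hm : ∫ T : Fin N → W, (∑ s, fun T : Fin N → W => x (T s)) T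
      ∂(Measure.pi fun _ => ν) = 0 := by
    simp only [Finset.sum_apply]
    rw [integral_finsetSum _ fun s _ => integrable_comp_eval (μ := fun _ : Fin N => ν) (i := s)
      (hx.integrable (by norm_num))]
    refine Finset.sum_eq_zero fun s _ => ?_
    rw [integral_comp_eval (μ := fun _ : Fin N => ν) (i := s) hx.aestronglyMeasurable, h0]
  have hmeas : ∀ s, AEMeasurable (fun T : Fin N → W => x (T s)) (Measure.pi fun _ => ν) := fun s =>
    (integrable_comp_eval (μ := fun _ : Fin N => ν) (i := s)
      (hx.integrable (by norm_num))).aemeasurable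
  have h := variance_sum_pi (μ := fun _ : Fin N => ν) (X := fun _ => x) fun _ => hx
  rw [variance_of_integral_eq_zero (Finset.aemeasurable_sum _ fun s _ => hmeas s) hm,
    variance_of_integral_eq_zero hx.aemeasurable h0] at h
  simpa using h

lemma integral_le_sqrt_integral_sq {W : Type*} {mW : MeasurableSpace W} {ν : Measure W}
    [IsProbabilityMeasure ν] {x : W → ℝ} (hx : MemLp x 2 ν) :
    ∫ w, x w ∂ν ≤ √(∫ w, x w ^ 2 ∂ν) := by
  refine Real.le_sqrt_of_sq_le ?_
  have := variance_nonneg x ν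
  rw [variance_eq_sub hx] at this
  simpa using this

lemma integral_boolSign_eval {m : ℕ} (k : Fin m) :
    ∫ b, boolSign (b k) ∂(signLaw m) = 0 := by
  have h := integral_signLaw_not fun b : Fin m → Bool => boolSign (b k)
  simp only [boolSign_not, integral_neg] at h
  linarith

/-- The Rademacher average of a Hilbert-Schmidt ball of linear maps in `L²`-normalised features:
by duality the supremum is the Hilbert-Schmidt norm of `∑ₛ εₛ ⊗ e(zₛ)`, whose second moment is
computed from independence. -/
lemma integral_iSup_sum_signSum_le {ι J : Type*} [Nonempty ι] [Finite ι] [Fintype J] {m : ℕ}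
    {Z : Type*} {mZ : MeasurableSpace Z} {μ : Measure Z} [IsProbabilityMeasure μ]
    {e : J → Z → ℝ} {M B : ℝ} (hB : 0 ≤ B) (he : ∀ j, Measurable (e j))
    (heM : ∀ j z, |e j z| ≤ M) (he2 : ∀ j, ∫ z, e j z ^ 2 ∂μ ≤ 1) {c : ι → Fin m → J → ℝ}
    (hc : ∀ i, ∑ k, ∑ j, c i k j ^ 2 ≤ B ^ 2) (N : ℕ) :
    ∫ T : Fin N → Z × (Fin m → Bool),
        ⨆ i, ∑ s, 4 * signSum (T s).2 (fun k => ∑ j, c i k j * e j (T s).1)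
        ∂(Measure.pi fun _ => μ.prod (signLaw m))
      ≤ 4 * B * √(N * (m * Fintype.card J)) := by
  set ν := μ.prod (signLaw m)
  set x : Fin m × J → Z × (Fin m → Bool) → ℝ := fun p w => boolSign (w.2 p.1) * e p.2 w.1
    with hxdef
  have hxm : ∀ p, Measurable (x p) := fun p => by
    have := measurable_boolSign
    have := he p.2
    fun_prop
  have hxM : ∀ p w, |x p w| ≤ M := fun p w => by
    rw [hxdef]
    simp only [abs_mul]
    have : |boolSign (w.2 p.1)| = 1 := by cases w.2 p.1 <;> simp [boolSign]
    rw [this, one_mul]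
    exact heM _ _
  have hx2 : ∀ p, MemLp (x p) 2 ν := fun p =>
    MemLp.of_bound (hxm p).aestronglyMeasurable M (.of_forall (hxM p))
  have hx0 : ∀ p, ∫ w, x p w ∂ν = 0 := fun p => by
    have := integral_prod_mul (μ := μ) (ν := signLaw m) (fun z => e p.2 z)
      (fun b => boolSign (b p.1))
    rw [integral_boolSign_eval, mul_zero] at this
    simpa only [hxdef, mul_comm] using this
  have hxv : ∀ p, ∫ w, x p w ^ 2 ∂ν ≤ 1 := fun p => by
    have := integral_prod_mul (μ := μ) (ν := signLaw m) (fun z => e p.2 z ^ 2) (fun _ => 1)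
    simp only [mul_one, integral_const, probReal_univ, one_smul] at this
    simp only [hxdef, mul_pow, boolSign_sq, one_mul]
    exact this.le.trans (he2 _)
  set Y : (Fin N → Z × (Fin m → Bool)) → ℝ := fun T => ∑ p, (∑ s, x p (T s)) ^ 2 with hY
  have hY0 : ∀ T, 0 ≤ Y T := fun T => Finset.sum_nonneg fun _ _ => sq_nonneg _
  have hYm : Measurable Y := by fun_prop
  have hsum2 : ∀ p, MemLp (fun T : Fin N → Z × (Fin m → Bool) => ∑ s, x p (T s)) 2
      (Measure.pi fun _ => ν) := fun p =>
    memLp_finsetSum _ fun s _ =>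
      MemLp.of_bound ((hxm p).comp (measurable_pi_apply s)).aestronglyMeasurable M
      (.of_forall fun T => hxM p (T s))
  have hYi : Integrable Y (Measure.pi fun _ => ν) :=
    integrable_finsetSum _ fun p _ => (hsum2 p).integrable_sq
  have hYle : ∫ T, Y T ∂(Measure.pi fun _ => ν) ≤ N * (m * Fintype.card J) := by
    rw [hY, integral_finsetSum _ fun p _ => (hsum2 p).integrable_sq]
    calc ∑ p, ∫ T : Fin N → Z × (Fin m → Bool), (∑ s, x p (T s)) ^ 2 ∂(Measure.pi fun _ => ν)
        ≤ ∑ p : Fin m × J, (N : ℝ) := by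
          refine Finset.sum_le_sum fun p _ => ?_
          rw [integral_sum_sq_of_mean_zero (hx2 p) (hx0 p)]
          exact mul_le_of_le_one_right (Nat.cast_nonneg _) (hxv p)
      _ = _ := by simp; ring
  have hsqrt : MemLp (fun T => √(Y T)) 2 (Measure.pi fun _ => ν) := by
    rw [memLp_two_iff_integrable_sq hYm.sqrt.aestronglyMeasurable]
    simpa only [Real.sq_sqrt (hY0 _)] using hYi
  have hpt : ∀ T : Fin N → Z × (Fin m → Bool),
      ⨆ i, ∑ s, 4 * signSum (T s).2 (fun k => ∑ j, c i k j * e j (T s).1)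
        ≤ 4 * B * √(Y T) := fun T => by
    refine ciSup_le fun i => ?_
    have hrw : ∑ s, 4 * signSum (T s).2 (fun k => ∑ j, c i k j * e j (T s).1)
        = 4 * ∑ p : Fin m × J, c i p.1 p.2 * ∑ s, x p (T s) := by
      simp only [signSum, ← Finset.mul_sum, Fintype.sum_prod_type, hxdef]
      congr 1
      rw [Finset.sum_comm]
      refine Finset.sum_congr rfl fun k _ => ?_
      simp only [Finset.mul_sum]
      rw [Finset.sum_comm]
      exact Finset.sum_congr rfl fun j _ => Finset.sum_congr rfl fun s _ => by ring
    rw [hrw, mul_assoc]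
    gcongr
    refine (Real.sum_mul_le_sqrt_mul_sqrt _ _ _).trans ?_
    gcongr
    rw [Fintype.sum_prod_type]
    exact (Real.sqrt_le_sqrt (hc i)).trans_eq (Real.sqrt_sq hB)
  have hbound : Integrable (fun T => 4 * B * √(Y T)) (Measure.pi fun _ => ν) :=
    (hsqrt.integrable (by norm_num)).const_mul _
  have hint : Integrable (fun T : Fin N → Z × (Fin m → Bool) =>
      ⨆ i, ∑ s, 4 * signSum (T s).2 (fun k => ∑ j, c i k j * e j (T s).1))
      (Measure.pi fun _ => ν) := by
    refine integrable_iSup (fun i => ?_) fun i => integrable_finsetSum _ fun s _ => ?_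
    · have := measurable_boolSign
      unfold signSum
      fun_prop
    · refine (integrable_finsetSum _ fun k _ => ?_).const_mul 4
      simp only [Finset.mul_sum]
      refine integrable_finsetSum _ fun j _ => ?_
      have h := (integrable_comp_eval (μ := fun _ : Fin N => ν) (i := s)
        ((hx2 (k, j)).integrable (by norm_num))).const_mul (c i k j)
      refine h.congr (.of_forall fun T => ?_)
      simp only [hxdef]
      ring
  calc _ ≤ ∫ T, 4 * B * √(Y T) ∂(Measure.pi fun _ => ν) := integral_mono hint hbound hpt
    _ ≤ 4 * B * √(∫ T, √(Y T) ^ 2 ∂(Measure.pi fun _ => ν)) := by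
        rw [integral_const_mul]
        gcongr
        exact integral_le_sqrt_integral_sq hsqrt
    _ ≤ _ := by
        simp only [Real.sq_sqrt (hY0 _)]
        gcongr

end LinearClass

/-! ### Uniform deviations -/

section UniformDeviation

/-- A uniform deviation bound for finitely many bounded losses that depend on the sample through
linear maps `c i`, in `L²`-normalised features `e`, in a 1-Lipschitz way. -/
theorem uniform_deviation {ι J : Type*} [Nonempty ι] [Finite ι] [Fintype J] {m N : ℕ}
    {Z : Type*} {mZ : MeasurableSpace Z} {μ : Measure Z} [IsProbabilityMeasure μ]
    {e : J → Z → ℝ} {M B b δ : ℝ} (hN : 0 < N) (hB : 0 ≤ B) (hb : 0 < b) (hδ₀ : 0 < δ)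
    (hδ₁ : δ < 1) (he : ∀ j, Measurable (e j))
    (heM : ∀ j z, |e j z| ≤ M) (he2 : ∀ j, ∫ z, e j z ^ 2 ∂μ ≤ 1) {c : ι → Fin m → J → ℝ}
    (hc : ∀ i, ∑ k, ∑ j, c i k j ^ 2 ≤ B ^ 2) {l : ι → Z → ℝ} (hlm : ∀ i, Measurable (l i))
    (hl0 : ∀ i z, 0 ≤ l i z) (hlb : ∀ i z, l i z ≤ b)
    (hl : ∀ i i' z, |l i z - l i' z|
      ≤ √(∑ k, (∑ j, c i k j * e j z - ∑ j, c i' k j * e j z) ^ 2)) :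
    (Measure.pi fun _ : Fin N => μ).real {S | ∃ i, 1 / (N : ℝ) * ∑ s, l i (S s) +
      (4 * B * √(m * Fintype.card J) + b * √(Real.log δ⁻¹ / 2)) / √N < ∫ z, l i z ∂μ} ≤ δ := by
  have hli : ∀ i, Integrable (l i) μ := fun i =>
    Integrable.of_bound (hlm i).aestronglyMeasurable b (.of_forall fun z => by
      rw [Real.norm_eq_abs, abs_of_nonneg (hl0 i z)]; exact hlb i z)
  set f : (Fin N → Z) → ℝ := fun S => ⨆ i, (0 + ∑ s, (∫ z, l i z ∂μ - l i (S s))) with hf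
  have hfm : Measurable f := Measurable.iSup fun i => by fun_prop
  have hei : ∀ j, Integrable (e j) μ := fun j =>
    Integrable.of_bound (he j).aestronglyMeasurable M (.of_forall (heM j))
  have hmean : ∫ S, f S ∂(Measure.pi fun _ => μ) ≤ 4 * B * √(N * (m * Fintype.card J)) := by
    have hvm : ∀ i k, Measurable fun z => ∑ j, c i k j * e j z := fun i k => by fun_prop
    have hvi : ∀ i k, Integrable (fun z => ∑ j, c i k j * e j z) μ := fun i k =>
      integrable_finsetSum _ fun j _ => (hei j).const_mul _
    refine le_trans (integral_iSup_sum_le (ν := μ.prod (signLaw m))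
      (g := fun i w => 4 * signSum w.2 fun k => ∑ j, c i k j * e j w.1)
      (fun i => by fun_prop) (fun i => ?_) (fun i => (integrable_const _).sub (hli i))
      (fun i => ?_) (fun A => integral_iSup_centered_le hlm hli hvm hvi hl A) N fun _ => 0) ?_
    · have := measurable_boolSign
      unfold signSum
      fun_prop
    · refine (integrable_finsetSum _ fun k _ => ?_).const_mul 4
      have hb : Integrable (fun b : Fin m → Bool => boolSign (b k)) (signLaw m) := .of_finite
      simpa only [mul_comm] using (hvi i k).mul_prod hb
    · simpa only [zero_add] using integral_iSup_sum_signSum_le hB he heM he2 hc N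
  have hint : ∀ i, ∫ z, l i z ∂μ ∈ Set.Icc 0 b := fun i => by
    refine ⟨integral_nonneg (hl0 i), ?_⟩
    simpa using integral_mono (hli i) (integrable_const b) (hlb i)
  have hterm : ∀ i z, |∫ z, l i z ∂μ - l i z| ≤ b := fun i z => by
    rw [abs_le]
    constructor <;> linarith [hl0 i z, hlb i z, (hint i).1, (hint i).2]
  have hfM : ∀ S, |f S| ≤ N * b := fun S => by
    have := abs_iSup_sub_iSup_le (a := fun i => 0 + ∑ s, (∫ z, l i z ∂μ - l i (S s)))
      (b := fun _ : ι => 0) (c := N * b) fun i => by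
        rw [zero_add, sub_zero]
        refine (Finset.abs_sum_le_sum_abs _ _).trans ?_
        simpa using Finset.sum_le_card_nsmul Finset.univ _ b fun s _ => hterm i (S s)
    simpa [hf] using this
  have hfd : ∀ S s z, |f (Function.update S s z) - f S| ≤ b := fun S s z => by
    refine abs_iSup_sub_iSup_le fun i => ?_
    rw [zero_add, zero_add, ← Finset.sum_sub_distrib, Finset.sum_eq_single s]
    · rw [Function.update_self, abs_le]
      constructor <;> linarith [hl0 i z, hlb i z, hl0 i (S s), hlb i (S s)]
    · intro s' _ hs'
      rw [Function.update_of_ne hs', sub_self]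
    · simp
  have hNpos : (0 : ℝ) < N := Nat.cast_pos.2 hN
  have hsN : 0 < √(N : ℝ) := Real.sqrt_pos.2 hNpos
  have hNsq : √(N : ℝ) * √N = N := Real.mul_self_sqrt hNpos.le
  have hlog : 0 < Real.log δ⁻¹ := Real.log_pos ((one_lt_inv₀ hδ₀).2 hδ₁)
  set t := b * √(N * (Real.log δ⁻¹ / 2)) with ht
  have ht0 : 0 ≤ t := by positivity
  refine le_trans (measureReal_mono ?_ (measure_ne_top _ _))
    ((measure_ge_le_of_bounded_differences (μ := μ) hfm hb.le ht0 hfM hfd).trans ?_)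
  · rintro S ⟨i, hi⟩
    have h1 : ∑ s, (∫ z, l i z ∂μ - l i (S s)) ≤ f S := by
      simpa [hf] using le_iSup_finite (fun i => 0 + ∑ s, (∫ z, l i z ∂μ - l i (S s))) i
    rw [Finset.sum_sub_distrib] at h1
    simp only [Finset.sum_const, Finset.card_univ, Fintype.card_fin, nsmul_eq_mul] at h1
    have h2 : N * (1 / (N : ℝ) * ∑ s, l i (S s) +
        (4 * B * √(m * Fintype.card J) + b * √(Real.log δ⁻¹ / 2)) / √N)
        = ∑ s, l i (S s) + (4 * B * √(N * (m * Fintype.card J)) + t) := by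
      rw [ht, Real.sqrt_mul hNpos.le, Real.sqrt_mul hNpos.le]
      have hdiv : (N : ℝ) / √N = √N := Real.div_sqrt
      rw [mul_add, ← mul_assoc, mul_one_div_cancel hNpos.ne', one_mul, mul_div_left_comm, hdiv]
      ring
    have h3 := mul_lt_mul_of_pos_left hi hNpos
    rw [h2] at h3
    rw [Set.mem_ofPred_eq]
    linarith
  · have : -t ^ 2 / (2 * (N * (b / 2) ^ 2)) = -Real.log δ⁻¹ := by
      rw [ht, mul_pow, Real.sq_sqrt (by positivity)]
      field_simp
    rw [this, Real.log_inv, neg_neg, Real.exp_log hδ₀]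

/-- The uniform deviation bound for arbitrary families: the coefficients form a totally bounded
set, and passing to a finite net costs less than any prescribed `κ > 0`. -/
theorem uniform_deviation_of_pos {ι J : Type*} [Fintype J] {m N : ℕ}
    {Z : Type*} {mZ : MeasurableSpace Z} {μ : Measure Z} [IsProbabilityMeasure μ]
    {e : J → Z → ℝ} {M B b δ κ : ℝ} (hN : 0 < N) (hM : 0 ≤ M) (hB : 0 ≤ B) (hb : 0 < b)
    (hδ₀ : 0 < δ) (hδ₁ : δ < 1) (hκ : 0 < κ) (he : ∀ j, Measurable (e j))
    (heM : ∀ j z, |e j z| ≤ M) (he2 : ∀ j, ∫ z, e j z ^ 2 ∂μ ≤ 1) {c : ι → Fin m → J → ℝ}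
    (hc : ∀ i, ∑ k, ∑ j, c i k j ^ 2 ≤ B ^ 2) {l : ι → Z → ℝ} (hlm : ∀ i, Measurable (l i))
    (hl0 : ∀ i z, 0 ≤ l i z) (hlb : ∀ i z, l i z ≤ b)
    (hl : ∀ i i' z, |l i z - l i' z|
      ≤ √(∑ k, (∑ j, c i k j * e j z - ∑ j, c i' k j * e j z) ^ 2)) :
    (Measure.pi fun _ : Fin N => μ).real {S | ∃ i, 1 / (N : ℝ) * ∑ s, l i (S s) +
      ((4 * B * √(m * Fintype.card J) + b * √(Real.log δ⁻¹ / 2)) / √N + κ)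
        < ∫ z, l i z ∂μ} ≤ δ := by
  rcases isEmpty_or_nonempty ι with hι | hι
  · simp [hδ₀.le]
  have hli : ∀ i, Integrable (l i) μ := fun i =>
    Integrable.of_bound (hlm i).aestronglyMeasurable b (.of_forall fun z => by
      rw [Real.norm_eq_abs, abs_of_nonneg (hl0 i z)]; exact hlb i z)
  set G : ℝ := √m * (Fintype.card J * M) with hG
  have hG0 : 0 ≤ G := by positivity
  -- A `ρ`-net of coefficients changes each loss by at most `G * ρ ≤ κ / 2`.
  set ρ : ℝ := κ / (2 * (G + 1)) with hρ
  have hρ0 : 0 < ρ := by positivity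
  have hGρ : G * ρ ≤ κ / 2 := by
    rw [hρ, mul_div_assoc', div_le_div_iff₀ (by positivity) (by positivity)]
    nlinarith
  have htb : TotallyBounded (Set.range c) := by
    refine (isCompact_closedBall (0 : Fin m → J → ℝ) B).totallyBounded.subset ?_
    rintro _ ⟨i, rfl⟩
    rw [mem_closedBall_zero_iff]
    refine (pi_norm_le_iff_of_nonneg hB).2 fun k => (pi_norm_le_iff_of_nonneg hB).2 fun j => ?_
    refine abs_le_of_sq_le_sq ?_ hB
    calc c i k j ^ 2 ≤ ∑ j, c i k j ^ 2 :=
          Finset.single_le_sum (f := fun j => c i k j ^ 2) (fun _ _ => sq_nonneg _)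
            (Finset.mem_univ j)
      _ ≤ ∑ k, ∑ j, c i k j ^ 2 :=
          Finset.single_le_sum (f := fun k => ∑ j, c i k j ^ 2)
            (fun _ _ => Finset.sum_nonneg fun _ _ => sq_nonneg _) (Finset.mem_univ k)
      _ ≤ B ^ 2 := hc i
  obtain ⟨t, htc, htf, hcov⟩ := htb.exists_subset (Metric.dist_mem_uniformity hρ0)
  have hex : ∀ y : t, ∃ i, c i = y := fun y => htc y.2
  choose r hr using hex
  have hnet : ∀ i, ∃ y : t, dist (c i) (c (r y)) < ρ := fun i => by
    have := hcov ⟨i, rfl⟩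
    simp only [Set.mem_iUnion] at this
    obtain ⟨y, hy, hdist⟩ := this
    exact ⟨⟨y, hy⟩, by rw [hr]; exact hdist⟩
  have hclose : ∀ i i' z, dist (c i) (c i') < ρ → |l i z - l i' z| ≤ κ / 2 := fun i i' z hd => by
    refine (hl i i' z).trans (le_trans ?_ hGρ)
    have hentry : ∀ k j, |c i k j - c i' k j| ≤ ρ := fun k j =>
      ((dist_le_pi_dist (c i k) (c i' k) j).trans (dist_le_pi_dist (c i) (c i') k)).trans hd.le
    have hrow : ∀ k, (∑ j, c i k j * e j z - ∑ j, c i' k j * e j z) ^ 2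
        ≤ (Fintype.card J * M * ρ) ^ 2 := fun k => by
      rw [← sq_abs]
      gcongr
      rw [← Finset.sum_sub_distrib]
      calc |∑ j, (c i k j * e j z - c i' k j * e j z)|
          ≤ ∑ j, |c i k j * e j z - c i' k j * e j z| := Finset.abs_sum_le_sum_abs _ _
        _ ≤ ∑ _j : J, ρ * M := by
            gcongr with j
            rw [← sub_mul, abs_mul]
            exact mul_le_mul (hentry k j) (heM j z) (abs_nonneg _) hρ0.le
        _ = Fintype.card J * M * ρ := by simp; ring
    calc √(∑ k, (∑ j, c i k j * e j z - ∑ j, c i' k j * e j z) ^ 2)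
        ≤ √(∑ _k : Fin m, (Fintype.card J * M * ρ) ^ 2) :=
          Real.sqrt_le_sqrt (Finset.sum_le_sum fun k _ => hrow k)
      _ = G * ρ := by
          rw [Finset.sum_const, Finset.card_univ, Fintype.card_fin, nsmul_eq_mul,
            Real.sqrt_mul (Nat.cast_nonneg _), Real.sqrt_sq (by positivity), hG]
          ring
  have : Finite t := htf
  have : Nonempty t := by
    obtain ⟨i₀⟩ := hι
    exact ⟨(hnet i₀).choose⟩
  refine le_trans (measureReal_mono ?_ (measure_ne_top _ _))
    (uniform_deviation (μ := μ) (ι := t) hN hB hb hδ₀ hδ₁ he heM he2 (fun y => hc (r y))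
      (fun y => hlm (r y)) (fun y => hl0 (r y)) (fun y => hlb (r y)) fun y y' => hl (r y) (r y'))
  rintro S ⟨i, hi⟩
  obtain ⟨y, hy⟩ := hnet i
  refine ⟨y, ?_⟩
  have h1 : ∫ z, l i z ∂μ ≤ ∫ z, l (r y) z ∂μ + κ / 2 := by
    have := integral_mono (hli i) ((hli (r y)).add (integrable_const (κ / 2))) fun z => by
      have := (abs_le.1 (hclose i (r y) z hy)).2
      simp only [Pi.add_apply]
      linarith
    rw [integral_add' (hli (r y)) (integrable_const _)] at this
    simpa using this
  have h2 : 1 / (N : ℝ) * ∑ s, l (r y) (S s) ≤ 1 / (N : ℝ) * ∑ s, l i (S s) + κ / 2 := by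
    calc 1 / (N : ℝ) * ∑ s, l (r y) (S s) ≤ 1 / (N : ℝ) * ∑ s, (l i (S s) + κ / 2) := by
          gcongr with s
          linarith [(abs_le.1 (hclose i (r y) (S s) hy)).1]
      _ = _ := by
          rw [Finset.sum_add_distrib]
          have : (N : ℝ) ≠ 0 := by positivity
          simp
          field_simp
  linarith

end UniformDeviation

/-! ### Orthonormal coordinates of linear functionals -/

section OrthogonalCoordinates

/-- Linear functionals on a finite-dimensional space have normalised coordinates that diagonalise
a second-moment form: `v` is an orthogonal basis of functionals, and `v j` divided by
`√(E (v j)²)` (which is zero when the second moment vanishes) are the features. Off the null set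
where some `v j` of zero second moment does not vanish, every functional is its
expansion in the features, with coefficients whose square sum is its second moment. -/
lemma exists_orthonormal_features {E Z : Type*} [AddCommGroup E] [Module ℝ E]
    [FiniteDimensional ℝ E] {mZ : MeasurableSpace Z} {μ : Measure Z} [IsProbabilityMeasure μ]
    (x : Z → E) (hx : ∀ f : Module.Dual ℝ E, MemLp (fun z => f (x z)) 2 μ) :
    ∃ e : Fin (Module.finrank ℝ E) → Module.Dual ℝ E,
      (∀ j, ∫ z, e j (x z) ^ 2 ∂μ ≤ 1) ∧
      ∃ a : Module.Dual ℝ E → Fin (Module.finrank ℝ E) → ℝ,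
        (∀ f, ∑ j, a f j ^ 2 = ∫ z, f (x z) ^ 2 ∂μ) ∧
        ∀ᵐ z ∂μ, ∀ f, f (x z) = ∑ j, a f j * e j (x z) := by
  have hmul : ∀ f g : Module.Dual ℝ E, Integrable (fun z => f (x z) * g (x z)) μ := fun f g =>
    (hx f).integrable_mul (hx g)
  let Q : LinearMap.BilinForm ℝ (Module.Dual ℝ E) :=
    LinearMap.mk₂ ℝ (fun f g => ∫ z, f (x z) * g (x z) ∂μ)
      (fun f f' g => by
        simp only [LinearMap.add_apply, add_mul]; exact integral_add (hmul _ _) (hmul _ _))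
      (fun r f g => by
        simp only [LinearMap.smul_apply, smul_eq_mul, mul_assoc]; exact integral_const_mul _ _)
      (fun f g g' => by
        simp only [LinearMap.add_apply, mul_add]; exact integral_add (hmul _ _) (hmul _ _))
      (fun r f g => by
        simp only [LinearMap.smul_apply, smul_eq_mul, mul_left_comm]
        exact integral_const_mul _ _)
  have hQ : ∀ f g, Q f g = ∫ z, f (x z) * g (x z) ∂μ := fun f g => rfl
  have hQs : LinearMap.IsSymm Q := ⟨fun f g => by simp [hQ, mul_comm]⟩
  obtain ⟨v₀, hv₀⟩ := LinearMap.BilinForm.exists_orthogonal_basis hQs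
  obtain ⟨v, hv⟩ : ∃ v : Module.Basis (Fin (Module.finrank ℝ E)) ℝ (Module.Dual ℝ E),
      LinearMap.IsOrthoᵢ Q v := by
    rw [← Subspace.dual_finrank_eq]
    exact ⟨v₀, hv₀⟩
  have hQ0 : ∀ f, 0 ≤ Q f f := fun f => integral_nonneg fun z => mul_self_nonneg _
  refine ⟨fun j => (√(Q (v j) (v j)))⁻¹ • v j, fun j => ?_,
    fun f j => v.repr f j * √(Q (v j) (v j)), fun f => ?_, ?_⟩
  · have : ∫ z, ((√(Q (v j) (v j)))⁻¹ • v j) (x z) ^ 2 ∂μ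
        = (√(Q (v j) (v j)))⁻¹ ^ 2 * Q (v j) (v j) := by
      rw [hQ, ← integral_const_mul]
      congr 1 with z
      simp only [LinearMap.smul_apply, smul_eq_mul]
      ring
    rw [this, inv_pow, Real.sq_sqrt (hQ0 _)]
    exact inv_mul_le_one
  · have hf : ∫ z, f (x z) ^ 2 ∂μ = Q f f := by simp only [hQ, sq]
    rw [hf]
    conv_rhs => rw [← v.sum_repr f]
    simp only [map_sum, LinearMap.sum_apply, map_smul, LinearMap.smul_apply, smul_eq_mul]
    refine Finset.sum_congr rfl fun j _ => ?_
    rw [Finset.sum_eq_single j]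
    · rw [mul_pow, Real.sq_sqrt (hQ0 _)]; ring
    · intro k _ hk
      rw [hv hk]; simp
    · simp
  · have hnull : ∀ j, ∀ᵐ z ∂μ, Q (v j) (v j) = 0 → v j (x z) = 0 := fun j => by
      by_cases h : Q (v j) (v j) = 0
      · have h' := (integral_eq_zero_iff_of_nonneg (fun z => mul_self_nonneg (v j (x z)))
          (hmul _ _)).1 h
        filter_upwards [h'] with z hz _
        exact mul_self_eq_zero.1 hz
      · exact .of_forall fun z hz => absurd hz h
    filter_upwards [ae_all_iff.2 hnull] with z hz f
    conv_lhs => rw [← v.sum_repr f]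
    simp only [LinearMap.sum_apply, LinearMap.smul_apply, smul_eq_mul]
    refine Finset.sum_congr rfl fun j _ => ?_
    rcases (hQ0 (v j)).eq_or_lt with h | h
    · rw [hz j h.symm]; simp
    · have := (Real.sqrt_pos.2 h).ne'
      field_simp

end OrthogonalCoordinates

/-! ### Frobenius norms and measurability -/

section Frobenius

variable {𝕜 p q : Type*} [RCLike 𝕜] [Fintype p] [Fintype q]

open scoped Matrix.Norms.Frobenius in
lemma frobNorm_nonneg (A : Matrix p q 𝕜) : 0 ≤ frobNorm A := norm_nonneg A

open scoped Matrix.Norms.Frobenius in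
lemma frobNorm_sub_le (A B : Matrix p q 𝕜) : frobNorm (A - B) ≤ frobNorm A + frobNorm B :=
  norm_sub_le A B

open scoped Matrix.Norms.Frobenius in
lemma abs_frobNorm_sub_frobNorm_le (A B : Matrix p q 𝕜) :
    |frobNorm A - frobNorm B| ≤ frobNorm (A - B) := abs_norm_sub_norm_le A B

open scoped Matrix.Norms.Frobenius in
lemma frobNorm_eq_sqrt (A : Matrix p q 𝕜) : frobNorm A = √(∑ i, ∑ j, ‖A i j‖ ^ 2) := by
  rw [Real.sqrt_eq_rpow, frobNorm, Matrix.frobenius_norm_def]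
  simp

lemma frobNorm_eq_sqrt_sum_prod (A : Matrix p q ℝ) :
    frobNorm A = √(∑ x : p × q, A x.1 x.2 ^ 2) := by
  rw [frobNorm_eq_sqrt, Fintype.sum_prod_type]
  simp

lemma exists_abs_dual_le_norm {E : Type*} [NormedAddCommGroup E] [NormedSpace ℝ E]
    [FiniteDimensional ℝ E] (f : Module.Dual ℝ E) : ∃ C, 0 ≤ C ∧ ∀ x, |f x| ≤ C * ‖x‖ :=
  ⟨‖LinearMap.toContinuousLinearMap f‖, norm_nonneg _,
    (LinearMap.toContinuousLinearMap f).le_opNorm⟩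

open scoped Matrix.Norms.Frobenius in
lemma exists_abs_dual_le_frobNorm (f : Module.Dual ℝ (Matrix p q 𝕜)) :
    ∃ C, 0 ≤ C ∧ ∀ A, |f A| ≤ C * frobNorm A :=
  exists_abs_dual_le_norm f

instance : BorelSpace (Matrix p q 𝕜) := inferInstanceAs (BorelSpace (p → q → 𝕜))

lemma measurable_dual (f : Module.Dual ℝ (Matrix p q 𝕜)) : Measurable f :=
  (LinearMap.continuous_of_finiteDimensional f).measurable

end Frobenius

/-! ### Linearity of the networks -/

section Network

variable {n nρ : ℕ}

lemma rotate_add (m : Fin n) (Λ Λ' : Matrix (Fin n) (Fin n) ℂ) :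
    rotate m (Λ + Λ') = rotate m Λ + rotate m Λ' := rfl

lemma rotate_smul (m : Fin n) (r : ℝ) (Λ : Matrix (Fin n) (Fin n) ℂ) :
    rotate m (r • Λ) = r • rotate m Λ := rfl

lemma phi₁_add (ω : ℝ) (K : Matrix (Fin n) (Fin nρ) ℂ) (D Λ Λ' : Matrix (Fin n) (Fin n) ℂ) :
    phi₁ ω K D (Λ + Λ') = phi₁ ω K D Λ + phi₁ ω K D Λ' := by
  simp only [phi₁, Matrix.mul_add, Matrix.add_mul, Matrix.diag_add, smul_add]
  abel

lemma phi₁_smul (ω : ℝ) (K : Matrix (Fin n) (Fin nρ) ℂ) (D Λ : Matrix (Fin n) (Fin n) ℂ) (r : ℝ) :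
    phi₁ ω K D (r • Λ) = r • phi₁ ω K D Λ := by
  simp only [phi₁, Matrix.mul_smul, Matrix.smul_mul, ← smul_add, Matrix.diag_smul]
  rw [smul_comm]

lemma phi₂_add (ω : ℝ) (K : Matrix (Fin n) (Fin nρ) ℂ) (Λ Λ' : Matrix (Fin n) (Fin n) ℂ) :
    phi₂ ω K (Λ + Λ') = phi₂ ω K Λ + phi₂ ω K Λ' := by
  simp only [phi₂, Matrix.mul_add, Matrix.add_mul, Matrix.diag_add, smul_add]

lemma phi₂_smul (ω : ℝ) (K : Matrix (Fin n) (Fin nρ) ℂ) (Λ : Matrix (Fin n) (Fin n) ℂ) (r : ℝ) :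
    phi₂ ω K (r • Λ) = r • phi₂ ω K Λ := by
  simp only [phi₂, Matrix.mul_smul, Matrix.smul_mul, Matrix.diag_smul]
  rw [smul_comm]

lemma block₁_add (ω₁ ω : ℝ) (K : Matrix (Fin n) (Fin nρ) ℂ) (D Λ Λ' : Matrix (Fin n) (Fin n) ℂ) :
    block₁ ω₁ ω K D (Λ + Λ') = block₁ ω₁ ω K D Λ + block₁ ω₁ ω K D Λ' := by
  simp only [block₁, ← Matrix.add_mul, rotate_add, phi₁_add]
  rfl

lemma block₁_smul (ω₁ ω : ℝ) (K : Matrix (Fin n) (Fin nρ) ℂ) (D Λ : Matrix (Fin n) (Fin n) ℂ)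
    (r : ℝ) : block₁ ω₁ ω K D (r • Λ) = r • block₁ ω₁ ω K D Λ := by
  simp only [block₁, ← Matrix.smul_mul, rotate_smul, phi₁_smul]
  rfl

lemma block₂_add (ω₁ ω : ℝ) (K : Matrix (Fin n) (Fin nρ) ℂ) (Λ Λ' : Matrix (Fin n) (Fin n) ℂ) :
    block₂ ω₁ ω K (Λ + Λ') = block₂ ω₁ ω K Λ + block₂ ω₁ ω K Λ' := by
  simp only [block₂, ← Matrix.add_mul, rotate_add, phi₂_add]
  rfl

lemma block₂_smul (ω₁ ω : ℝ) (K : Matrix (Fin n) (Fin nρ) ℂ) (Λ : Matrix (Fin n) (Fin n) ℂ)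
    (r : ℝ) : block₂ ω₁ ω K (r • Λ) = r • block₂ ω₁ ω K Λ := by
  simp only [block₂, ← Matrix.smul_mul, rotate_smul, phi₂_smul]
  rfl

lemma upper_add (Λ Λ' : Stacked n ℂ) : upper (Λ + Λ') = upper Λ + upper Λ' := rfl
lemma lower_add (Λ Λ' : Stacked n ℂ) : lower (Λ + Λ') = lower Λ + lower Λ' := rfl
lemma upper_smul (r : ℝ) (Λ : Stacked n ℂ) : upper (r • Λ) = r • upper Λ := rfl
lemma lower_smul (r : ℝ) (Λ : Stacked n ℂ) : lower (r • Λ) = r • lower Λ := rfl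

/-- An uncompressed network is linear in the scattering data. -/
lemma isLinearMap_phiNet (ω₁ ω₂ : ℝ) (K : Matrix (Fin n) (Fin nρ) ℂ)
    (D : Matrix (Fin n) (Fin n) ℂ) : IsLinearMap ℝ (phiNet ω₁ ω₂ K D) := by
  constructor
  · intro Λ Λ'
    simp only [phiNet, upper_add, lower_add, block₁_add, block₂_add]
    ext (i | i) j <;> simp <;> ring
  · intro r Λ
    simp only [phiNet, upper_smul, lower_smul, block₁_smul, block₂_smul]
    ext (i | i) j <;> simp

lemma exists_linearMap_of_mem_classH {ω₁ ω₂ α BK BD : ℝ} {h : Stacked n ℂ → Stacked n ℝ}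
    (hh : h ∈ classH n nρ ω₁ ω₂ α BK BD) : ∃ T : Stacked n ℂ →ₗ[ℝ] Stacked n ℝ, h = T := by
  obtain ⟨ψ, ψ₀, -, -, φ, ⟨K, D, -, -, rfl⟩, rfl⟩ := hh
  exact ⟨ψ ∘ₗ ψ₀ ∘ₗ (isLinearMap_phiNet ω₁ ω₂ K D).mk', rfl⟩

lemma frobNorm_le_of_mem_classH {ω₁ ω₂ α BK BD Bout : ℝ} (hα : 0 < α)
    {h : Stacked n ℂ → Stacked n ℝ} (hh : h ∈ classH n nρ ω₁ ω₂ α BK BD) {Λ : Stacked n ℂ}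
    (hΛ : ∀ φ ∈ classBFNN n nρ ω₁ ω₂ BK BD, frobNorm (φ Λ) ≤ Bout) :
    frobNorm (h Λ) ≤ 4 * α⁻¹ * Bout := by
  obtain ⟨ψ, ψ₀, hψ, hψ₀, φ, hφ, rfl⟩ := hh
  calc frobNorm (ψ (ψ₀ (φ Λ))) ≤ 2 * α⁻¹ * (2 * frobNorm (φ Λ)) :=
        (hψ _).trans (by gcongr; exact hψ₀ _)
    _ ≤ 2 * α⁻¹ * (2 * Bout) := by gcongr; exact hΛ φ hφ
    _ = 4 * α⁻¹ * Bout := by ring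

lemma finrank_stacked (n : ℕ) : Module.finrank ℝ (Stacked n ℂ) = 4 * n ^ 2 := by
  rw [Module.finrank_matrix, Complex.finrank_real_complex]
  simp
  ring

end Network

/-! ### The generalization bound -/

/-- The sample complexity bound with the constants that the linear structure gives, up to an
arbitrary `κ > 0`. -/
theorem generalization_bound {n nρ N : ℕ} (hN : 0 < N)
    {ω₁ ω₂ α BK BD Bin Btgt Bout : ℝ} (hα : 0 < α) (hBout : 0 < Bout)
    {μ : Measure (Sample n)} [IsProbabilityMeasure μ]
    (hin : ∀ᵐ z ∂μ, frobNorm z.1 ≤ Bin) (htgt : ∀ᵐ z ∂μ, frobNorm z.2 ≤ Btgt)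
    (hφ : ∀ᵐ z ∂μ, ∀ φ ∈ classBFNN n nρ ω₁ ω₂ BK BD, frobNorm (φ z.1) ≤ Bout)
    (hh : ∀ᵐ z ∂μ, ∀ h ∈ classH n nρ ω₁ ω₂ α BK BD, frobNorm (h z.1) ≤ Bout)
    {δ κ : ℝ} (hδ₀ : 0 < δ) (hδ₁ : δ < 1) (hκ : 0 < κ) :
    (Measure.pi fun _ : Fin N => μ).real {S | ∃ h ∈ classH n nρ ω₁ ω₂ α BK BD,
      empRisk h S + ((4 * (4 * α⁻¹ * Bout) * √((2 * n ^ 2 : ℕ) * (4 * n ^ 2 : ℕ))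
        + (Bout + Btgt) * √(Real.log δ⁻¹ / 2)) / √N + κ) < risk μ h} ≤ δ := by
  have hdual : ∀ f : Module.Dual ℝ (Stacked n ℂ), Measurable fun z : Sample n => f z.1 :=
    fun f => (measurable_dual f).comp measurable_fst
  have hmem : ∀ f : Module.Dual ℝ (Stacked n ℂ), MemLp (fun z : Sample n => f z.1) 2 μ := by
    intro f
    obtain ⟨C, hC0, hC⟩ := exists_abs_dual_le_frobNorm f
    refine MemLp.of_bound (hdual f).aestronglyMeasurable (C * Bin) ?_
    filter_upwards [hin] with z hz
    exact (hC z.1).trans (by gcongr)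
  obtain ⟨e, he2, a, ha, hea⟩ := exists_orthonormal_features (μ := μ) (fun z : Sample n => z.1) hmem
  obtain ⟨Z₀, hZ₀, hZ₀m, hgood⟩ := Filter.Eventually.exists_measurable_mem
    (hin.and (htgt.and (hφ.and (hh.and hea))))
  have hZ₀ae : ∀ᵐ z ∂μ, z ∈ Z₀ := hZ₀
  obtain ⟨z₀, hz₀⟩ := hZ₀ae.exists
  have hBin : 0 ≤ Bin := (frobNorm_nonneg _).trans (hgood z₀ hz₀).1
  have hBtgt : 0 ≤ Btgt := (frobNorm_nonneg _).trans (hgood z₀ hz₀).2.1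
  choose C hC0 hC using fun j => exists_abs_dual_le_frobNorm (e j)
  let ι := {T : Stacked n ℂ →ₗ[ℝ] Stacked n ℝ // ⇑T ∈ classH n nρ ω₁ ω₂ α BK BD}
  have hcard : Fintype.card ((Fin n ⊕ Fin n) × Fin n) = 2 * n ^ 2 := by simp; ring
  let σ : (Fin n ⊕ Fin n) × Fin n ≃ Fin (2 * n ^ 2) := Fintype.equivFinOfCardEq hcard
  let comp : ι → (Fin n ⊕ Fin n) × Fin n → Module.Dual ℝ (Stacked n ℂ) := fun T p =>
    Matrix.entryLinearMap ℝ ℝ p.1 p.2 ∘ₗ T.1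
  have hcomp : ∀ T p Λ, comp T p Λ = T.1 Λ p.1 p.2 := fun T p Λ => rfl
  let c : ι → Fin (2 * n ^ 2) → Fin (Module.finrank ℝ (Stacked n ℂ)) → ℝ := fun T k =>
    a (comp T (σ.symm k))
  -- Outside the good set the features and the losses are set to zero.
  let l : ι → Sample n → ℝ := fun T => Z₀.indicator (loss T.1)
  have hlossm : ∀ T : ι, Measurable (loss T.1) := fun T => by
    rw [show loss T.1 = fun z : Sample n => √(∑ p, (comp T p z.1 - z.2 p.1 p.2) ^ 2) from
      funext fun z => frobNorm_eq_sqrt_sum_prod _]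
    have h1 : ∀ p, Measurable fun z : Sample n => comp T p z.1 := fun p => hdual _
    have h2 : ∀ p : (Fin n ⊕ Fin n) × Fin n, Measurable fun z : Sample n => z.2 p.1 p.2 :=
      fun p => (measurable_dual (Matrix.entryLinearMap ℝ ℝ p.1 p.2)).comp measurable_snd
    fun_prop
  have hlip : ∀ (T T' : ι) z, |l T z - l T' z| ≤ √(∑ k, (∑ j, c T k j *
      Z₀.indicator (fun z : Sample n => e j z.1) z - ∑ j, c T' k j *
      Z₀.indicator (fun z : Sample n => e j z.1) z) ^ 2) := by
    intro T T' z
    by_cases hz : z ∈ Z₀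
    · simp only [l, Set.indicator_of_mem hz, loss]
      refine (abs_frobNorm_sub_frobNorm_le _ _).trans_eq ?_
      rw [sub_sub_sub_cancel_right, frobNorm_eq_sqrt_sum_prod, ← σ.symm.sum_comp]
      congr 2 with k
      rw [Matrix.sub_apply, ← hcomp T (σ.symm k), ← hcomp T' (σ.symm k),
        (hgood z hz).2.2.2.2 (comp T (σ.symm k)), (hgood z hz).2.2.2.2 (comp T' (σ.symm k))]
    · simp [l, Set.indicator_of_notMem hz]
  have hcB : ∀ T, ∑ k, ∑ j, c T k j ^ 2 ≤ (4 * α⁻¹ * Bout) ^ 2 := by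
    intro T
    have hsq : ∀ p, Integrable (fun z : Sample n => comp T p z.1 ^ 2) μ := fun p =>
      (hmem _).integrable_sq
    simp only [c, ha]
    rw [σ.symm.sum_comp (fun p => ∫ z, comp T p z.1 ^ 2 ∂μ),
      ← integral_finsetSum _ fun p _ => hsq p]
    have hbd : ∀ᵐ z ∂μ, ∑ p, comp T p z.1 ^ 2 ≤ (4 * α⁻¹ * Bout) ^ 2 := by
      filter_upwards [hφ] with z hz
      have h := frobNorm_le_of_mem_classH hα T.2 hz
      rw [frobNorm_eq_sqrt_sum_prod] at h
      exact (Real.sqrt_le_left (by positivity)).1 h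
    simpa using integral_mono_ae (integrable_finsetSum _ fun p _ => hsq p)
      (integrable_const _) hbd
  have key := uniform_deviation_of_pos (μ := μ) (N := N) (M := (∑ j, C j) * Bin)
    (B := 4 * α⁻¹ * Bout) (b := Bout + Btgt) (δ := δ) (κ := κ)
    (e := fun j => Z₀.indicator fun z : Sample n => e j z.1) (c := c) (l := l) hN
    (mul_nonneg (Finset.sum_nonneg fun j _ => hC0 j) hBin) (by positivity) (by positivity)
    hδ₀ hδ₁ hκ (fun j => (hdual _).indicator hZ₀m) ?_ ?_ hcB
    (fun T => (hlossm T).indicator hZ₀m)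
    (fun T z => Set.indicator_nonneg (fun z _ => frobNorm_nonneg _) z) ?_ hlip
  · rw [Fintype.card_fin, finrank_stacked] at key
    -- Almost surely the sample lies in the good set, where the losses are the original ones.
    have hall : ∀ᵐ S ∂(Measure.pi fun _ : Fin N => μ), ∀ s, S s ∈ Z₀ := by
      rw [ae_all_iff]
      exact fun s => (Measure.quasiMeasurePreserving_eval (fun _ : Fin N => μ) s).ae hZ₀ae
    refine le_trans (ENNReal.toReal_mono (measure_ne_top _ _) (measure_mono_ae ?_)) key
    filter_upwards [hall] with S hS
    rintro ⟨h, hhm, hlt⟩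
    obtain ⟨T, rfl⟩ := exists_linearMap_of_mem_classH hhm
    refine ⟨⟨T, hhm⟩, ?_⟩
    have h1 : ∫ z, l ⟨T, hhm⟩ z ∂μ = risk μ T := by
      refine integral_congr_ae ?_
      filter_upwards [hZ₀ae] with z hz
      simp [l, Set.indicator_of_mem hz]
    have h2 : 1 / (N : ℝ) * ∑ s, l ⟨T, hhm⟩ (S s) = empRisk T S := by
      simp only [empRisk, l, Set.indicator_of_mem (hS _)]
    rw [h1, h2]
    exact hlt
  · intro j z
    by_cases hz : z ∈ Z₀
    · rw [Set.indicator_of_mem hz]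
      calc |e j z.1| ≤ C j * frobNorm z.1 := hC j _
        _ ≤ (∑ j, C j) * Bin := by
          refine mul_le_mul (Finset.single_le_sum (fun j _ => hC0 j) (Finset.mem_univ j))
            (hgood z hz).1 (frobNorm_nonneg _) (Finset.sum_nonneg fun j _ => hC0 j)
    · rw [Set.indicator_of_notMem hz, abs_zero]
      exact mul_nonneg (Finset.sum_nonneg fun j _ => hC0 j) hBin
  · intro j
    refine le_trans (le_of_eq (integral_congr_ae ?_)) (he2 j)
    filter_upwards [hZ₀ae] with z hz
    rw [Set.indicator_of_mem hz]
  · intro T z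
    by_cases hz : z ∈ Z₀
    · simp only [l, Set.indicator_of_mem hz]
      exact (frobNorm_sub_le _ _).trans
        (add_le_add ((hgood z hz).2.2.2.1 _ T.2) (hgood z hz).2.1)
    · simp only [l, Set.indicator_of_notMem hz]
      positivity

/-- Every term that the linear structure does not need is at least one: `√(ω₂/ω₁)`, the factor
involving `c₀`, and a power of `n`. -/
lemma rate_lt {n N : ℕ} (hn : 0 < n) (hN : 0 < N) {ω₁ ω₂ α BK BD Bin Btgt Bout δ : ℝ}
    (hω₁ : 0 < ω₁) (hω : ω₁ < ω₂) (hα : 0 < α) (hBin : 0 ≤ Bin) (hBtgt : 0 ≤ Btgt)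
    (hBout : 0 < Bout) (hδ₀ : 0 < δ) (hδ₁ : δ < 1) :
    (4 * (4 * α⁻¹ * Bout) * √((2 * n ^ 2 : ℕ) * (4 * n ^ 2 : ℕ))
        + (Bout + Btgt) * √(Real.log δ⁻¹ / 2)) / √N
      < 2 ^ 2 * (√(2 * Real.log (4 * δ⁻¹)) * (Bout + Btgt) +
            2 ^ 6 * 3 * √(ω₂ / ω₁) * Bout * α⁻¹ *
              √(1 + c₀ ω₁ ω₂ BK BD Bin * Bout⁻¹ * (n : ℝ) ^ (-(3 / 2) : ℝ)) *
              (n : ℝ) ^ 3) * (N : ℝ) ^ (-(1 / 2) : ℝ) := by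
  have hn1 : (1 : ℝ) ≤ n := Nat.one_le_cast.2 hn
  have hNpos : (0 : ℝ) < N := Nat.cast_pos.2 hN
  have hc₀ : 0 ≤ c₀ ω₁ ω₂ BK BD Bin := by unfold c₀; positivity
  have hr1 : 1 ≤ √(ω₂ / ω₁) := Real.one_le_sqrt.2 ((one_le_div hω₁).2 hω.le)
  have hr2 : 1 ≤ √(1 + c₀ ω₁ ω₂ BK BD Bin * Bout⁻¹ * (n : ℝ) ^ (-(3 / 2) : ℝ)) := by
    refine Real.one_le_sqrt.2 (le_add_of_nonneg_right ?_)
    positivity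
  have hn23 : (n : ℝ) ^ 2 ≤ (n : ℝ) ^ 3 := pow_le_pow_right₀ hn1 (by norm_num)
  have hdim : √((2 * n ^ 2 : ℕ) * (4 * n ^ 2 : ℕ)) ≤ 3 * (n : ℝ) ^ 2 := by
    rw [Real.sqrt_le_left (by positivity)]
    push_cast
    nlinarith [pow_pos (zero_lt_one.trans_le hn1) 4]
  have hlog0 : 0 < Real.log δ⁻¹ := Real.log_pos ((one_lt_inv₀ hδ₀).2 hδ₁)
  have hlog : √(Real.log δ⁻¹ / 2) ≤ √(2 * Real.log (4 * δ⁻¹)) := by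
    refine Real.sqrt_le_sqrt ?_
    have : Real.log δ⁻¹ ≤ Real.log (4 * δ⁻¹) :=
      Real.log_le_log (by positivity) (by linarith [inv_pos.2 hδ₀])
    linarith
  have hP : 0 < Bout * α⁻¹ := by positivity
  have hcube : (n : ℝ) ^ 3 ≤ √(ω₂ / ω₁) *
      √(1 + c₀ ω₁ ω₂ BK BD Bin * Bout⁻¹ * (n : ℝ) ^ (-(3 / 2) : ℝ)) * (n : ℝ) ^ 3 :=
    le_mul_of_one_le_left (by positivity) (one_le_mul_of_one_le_of_one_le hr1 hr2)
  rw [Real.rpow_neg hNpos.le, ← Real.sqrt_eq_rpow, div_eq_mul_inv]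
  refine mul_lt_mul_of_pos_right ?_ (inv_pos.2 (Real.sqrt_pos.2 hNpos))
  have h1 : 4 * (4 * α⁻¹ * Bout) * √((2 * n ^ 2 : ℕ) * (4 * n ^ 2 : ℕ))
      ≤ Bout * α⁻¹ * (48 * (n : ℝ) ^ 3) := by
    calc _ ≤ 4 * (4 * α⁻¹ * Bout) * (3 * (n : ℝ) ^ 2) := by gcongr
      _ = Bout * α⁻¹ * (48 * (n : ℝ) ^ 2) := by ring
      _ ≤ _ := by gcongr
  have h2 : Bout * α⁻¹ * (48 * (n : ℝ) ^ 3) < Bout * α⁻¹ * (768 * (n : ℝ) ^ 3) := by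
    gcongr
    norm_num
  have h3 := mul_le_mul_of_nonneg_left hcube (a := 768 * (Bout * α⁻¹)) (by positivity)
  have h4 : (Bout + Btgt) * √(Real.log δ⁻¹ / 2)
      ≤ 4 * (√(2 * Real.log (4 * δ⁻¹)) * (Bout + Btgt)) := by
    calc _ ≤ (Bout + Btgt) * √(2 * Real.log (4 * δ⁻¹)) := by gcongr
      _ ≤ _ := by nlinarith [show 0 ≤ √(2 * Real.log (4 * δ⁻¹)) * (Bout + Btgt) by positivity]
  linarith

end BFNN

theorem mainTheorem7
    (n nρ N q : ℕ) (hn : 0 < n) (hN : 0 < N)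
    (ω₁ ω₂ : ℝ) (hω₁ : 0 < ω₁) (hω : ω₁ < ω₂) (hq : ω₂ = q * ω₁) (hnρ : nρ = q * n)
    (α BK BD Bin Btgt Bout : ℝ) (hα : 0 < α) (hBout : 0 < Bout)
    (μ : Measure (BFNN.Sample n)) [IsProbabilityMeasure μ]
    (hin : ∀ᵐ z ∂μ, BFNN.frobNorm z.1 ≤ Bin)
    (htgt : ∀ᵐ z ∂μ, BFNN.frobNorm z.2 ≤ Btgt)
    (hφ : ∀ᵐ z ∂μ, ∀ φ ∈ BFNN.classBFNN n nρ ω₁ ω₂ BK BD, BFNN.frobNorm (φ z.1) ≤ Bout)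
    (hh : ∀ᵐ z ∂μ, ∀ h ∈ BFNN.classH n nρ ω₁ ω₂ α BK BD, BFNN.frobNorm (h z.1) ≤ Bout)
    (δ : ℝ) (hδ₀ : 0 < δ) (hδ₁ : δ < 1) :
    1 - δ ≤ (Measure.pi fun _ : Fin N => μ).real
      {S | ∀ h ∈ BFNN.classH n nρ ω₁ ω₂ α BK BD,
        BFNN.risk μ h ≤ BFNN.empRisk h S +
          2 ^ 2 * (Real.sqrt (2 * Real.log (4 * δ⁻¹)) * (Bout + Btgt) +
            2 ^ 6 * 3 * Real.sqrt (ω₂ / ω₁) * Bout * α⁻¹ *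
              Real.sqrt (1 + BFNN.c₀ ω₁ ω₂ BK BD Bin * Bout⁻¹ * (n : ℝ) ^ (-(3 / 2) : ℝ)) *
              (n : ℝ) ^ 3) * (N : ℝ) ^ (-(1 / 2) : ℝ)} := by
  obtain ⟨z, hz₁, hz₂⟩ := (hin.and htgt).exists
  have hrate := BFNN.rate_lt (BK := BK) (BD := BD) hn hN hω₁ hω hα
    ((BFNN.frobNorm_nonneg _).trans hz₁) ((BFNN.frobNorm_nonneg _).trans hz₂) hBout hδ₀ hδ₁
  have hbad := BFNN.generalization_bound hN hα hBout hin htgt hφ hh hδ₀ hδ₁ (sub_pos.2 hrate)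
  rw [add_sub_cancel] at hbad
  -- The events need not be measurable, so only subadditivity is used.
  have hcover := measureReal_union_le (μ := Measure.pi fun _ : Fin N => μ)
    {S | ∀ h ∈ BFNN.classH n nρ ω₁ ω₂ α BK BD,
        BFNN.risk μ h ≤ BFNN.empRisk h S +
          2 ^ 2 * (Real.sqrt (2 * Real.log (4 * δ⁻¹)) * (Bout + Btgt) +
            2 ^ 6 * 3 * Real.sqrt (ω₂ / ω₁) * Bout * α⁻¹ *
              Real.sqrt (1 + BFNN.c₀ ω₁ ω₂ BK BD Bin * Bout⁻¹ * (n : ℝ) ^ (-(3 / 2) : ℝ)) *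
              (n : ℝ) ^ 3) * (N : ℝ) ^ (-(1 / 2) : ℝ)}
    {S | ∃ h ∈ BFNN.classH n nρ ω₁ ω₂ α BK BD, BFNN.empRisk h S +
          2 ^ 2 * (Real.sqrt (2 * Real.log (4 * δ⁻¹)) * (Bout + Btgt) +
            2 ^ 6 * 3 * Real.sqrt (ω₂ / ω₁) * Bout * α⁻¹ *
              Real.sqrt (1 + BFNN.c₀ ω₁ ω₂ BK BD Bin * Bout⁻¹ * (n : ℝ) ^ (-(3 / 2) : ℝ)) *
              (n : ℝ) ^ 3) * (N : ℝ) ^ (-(1 / 2) : ℝ) < BFNN.risk μ h}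
  rw [show ∀ s t : Set (Fin N → BFNN.Sample n), s ∪ t = Set.univ →
      (Measure.pi fun _ => μ).real (s ∪ t) = 1 from
    fun s t h => by rw [h, probReal_univ]] at hcover
  · linarith
  · refine Set.eq_univ_of_forall fun S => or_iff_not_imp_left.2 fun hS => ?_
    simpa using hS
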